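/- Let $\mathbb K\in\{\mathbb R,\mathbb C\}$, $n\in\mathbb N$ and $a<b$. Let $P_1,P_0\in\mathbb R^{n\times n}$ with $P_1$ symmetric and invertible and $P_0^\top=-P_0$. Let $H\in C^1([a,b],\mathbb R^{n\times n})$ be such that $H(\zeta)$ is symmetric and $m\mathbf 1_n\le H(\zeta)\le M\mathbf 1_n$ for all $\zeta\in[a,b]$, with constants $m,M>0$. Let $W_B\in\mathbb R^{n\times 2n}$ have rank $n$ and satisfy $W_B\begin{pmatrix}0&\mathbf 1_n\\ \mathbf 1_n&0\end{pmatrix}W_B^\top\ge 0$. On $\mathcal X=L^2([a,b],\mathbb K^n)$, with the norm given by $\|f\|_{\mathcal X}^2=\tfrac12\int_a^b f(\zeta)^*H(\zeta)f(\zeta)\,\mathrm d\zeta$, consider the operator $Ax=P_1\frac{\mathrm d}{\mathrm d\zeta}(Hx)+P_0Hx$ whose domain $D(A)$ consists of all $x\in L^2([a,b],\mathbb K^n)$ with $Hx\in H^1([a,b],\mathbb K^n)$ and $$W_B\begin{pmatrix}e_\partial\\ f_\partial\end{pmatrix}=0,\qquad \begin{pmatrix}e_\partial\\ f_\partial\end{pmatrix}=\frac1{\sqrt2}\begin{pmatrix}\mathbf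 1_n&\mathbf 1_n\\ P_1&-P_1\end{pmatrix}\begin{pmatrix}(Hx)(b)\\ (Hx)(a)\end{pmatrix}.$$ A classical solution is a function $x\in C^1([0,\infty),\mathcal X)$ with $x(t)\in D(A)$ and $\dot x(t)=Ax(t)$ for all $t\ge 0$; for $\delta\in[a,b]$, $x(t,\delta)$ denotes the value at $\delta$ of the continuous representative of $x(t)$, and $(x^*Hx)(t,\delta)=x(t,\delta)^*H(\delta)x(t,\delta)$. Let $\sigma,\tau,\gamma>0$ satisfy $\gamma(b-a)\le\sigma<\tau$ and $\gamma H(\zeta)\ge\pm P_1^{-1}$ for all $\zeta\in[a,b]$, and set $S=\sigma-\gamma(b-a)$, $T=\tau+\gamma(b-a)$. Then there are constants $c,d>0$ such that for every classical solution $x$ and for both $\delta=a$ and $\delta=b$, the function $t\mapsto(x^*Hx)(t,\delta)$ is integrable on $[S,T]$ and $$\|x(T)\|_{\mathcal X}^2\le c\int_S^T(x^*Hx)(t,\delta)\,\mathrm dt,\qquad \int_\sigma^\tau(x^*Hx)(t,\delta)\,\mathrm dt\le d\,\|x(S)\|_{\mathcal X}^2.$$ -/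

import Mathlib

namespace PortHam

open MeasureTheory Set

/-- `𝕂ⁿ` with its Euclidean norm. -/
abbrev Vec (𝕂 : Type*) [RCLike 𝕂] (n : ℕ) : Type _ := EuclideanSpace 𝕂 (Fin n)

/-- `L²([a,b], 𝕂ⁿ)`. -/
abbrev L2 (𝕂 : Type*) [RCLike 𝕂] (n : ℕ) (a b : ℝ) : Type _ :=
  Lp (Vec 𝕂 n) 2 (volume.restrict (Icc a b))

/-- A real matrix acting on `𝕂ⁿ`. -/
noncomputable def act (𝕂 : Type*) [RCLike 𝕂] {n : ℕ} (M : Matrix (Fin n) (Fin n) ℝ) :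
    Vec 𝕂 n →ₗ[𝕂] Vec 𝕂 n :=
  Matrix.toEuclideanLin (M.map (algebraMap ℝ 𝕂))

/-- The (real) value `v* M v`, for a real symmetric matrix `M` and `v ∈ 𝕂ⁿ`. -/
noncomputable def quadForm (𝕂 : Type*) [RCLike 𝕂] {n : ℕ} (M : Matrix (Fin n) (Fin n) ℝ)
    (v : Vec 𝕂 n) : ℝ :=
  RCLike.re (inner 𝕂 v (act 𝕂 M v))

/-- The coefficients of a port-Hamiltonian system; the columns of `W_B` are split into the block
acting on the boundary effort and the block acting on the boundary flow. -/
structure System (n : ℕ) where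
  P₁ : Matrix (Fin n) (Fin n) ℝ
  P₀ : Matrix (Fin n) (Fin n) ℝ
  H : ℝ → Matrix (Fin n) (Fin n) ℝ
  W_B : Matrix (Fin n) (Fin n ⊕ Fin n) ℝ

/-- The standing assumptions on the coefficients, on the spatial domain `[a,b]`. -/
structure System.Admissible {n : ℕ} (Q : System n) (a b : ℝ) : Prop where
  rank_W_B : Q.W_B.rank = n
  W_B_nonneg : (Q.W_B * (Matrix.fromBlocks 0 1 1 0 : Matrix (Fin n ⊕ Fin n) (Fin n ⊕ Fin n) ℝ) *
    Q.W_B.transpose).PosSemidef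
  H_contDiff : ∀ i j, ContDiffOn ℝ 1 (fun ζ => Q.H ζ i j) (Icc a b)
  H_symm : ∀ ζ ∈ Icc a b, (Q.H ζ).IsSymm
  H_bounds : ∃ m M : ℝ, 0 < m ∧ 0 < M ∧ ∀ ζ ∈ Icc a b,
    (Q.H ζ - m • (1 : Matrix (Fin n) (Fin n) ℝ)).PosSemidef ∧
    (M • (1 : Matrix (Fin n) (Fin n) ℝ) - Q.H ζ).PosSemidef
  P₁_symm : Q.P₁.IsSymm
  P₁_invertible : IsUnit Q.P₁
  P₀_skew : Q.P₀.transpose = -Q.P₀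

/-- The boundary effort `e_∂` of a function with boundary values `ub` at `b` and `ua` at `a`. -/
noncomputable def effort {𝕂 : Type*} [RCLike 𝕂] {n : ℕ} (ub ua : Vec 𝕂 n) : Vec 𝕂 n :=
  ((1 / Real.sqrt 2 : ℝ) : 𝕂) • (ub + ua)

/-- The boundary flow `f_∂` of a function with boundary values `ub` at `b` and `ua` at `a`. -/
noncomputable def System.flow {𝕂 : Type*} [RCLike 𝕂] {n : ℕ} (Q : System n) (ub ua : Vec 𝕂 n) :
    Vec 𝕂 n :=
  ((1 / Real.sqrt 2 : ℝ) : 𝕂) • (act 𝕂 Q.P₁ ub - act 𝕂 Q.P₁ ua)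

/-- The boundary condition `W_B (e_∂; f_∂) = 0`. -/
def System.BoundaryCondition {𝕂 : Type*} [RCLike 𝕂] {n : ℕ} (Q : System n)
    (ub ua : Vec 𝕂 n) : Prop :=
  (Q.W_B.map (algebraMap ℝ 𝕂)).mulVec
    (Sum.elim (fun i => effort ub ua i) (fun i => Q.flow ub ua i)) = 0

/-- `u ∈ H¹([a,b], 𝕂ⁿ)` with derivative `v ∈ L²([a,b], 𝕂ⁿ)`: on `[a,b]` the function `u` is
absolutely continuous, being the primitive of the square-integrable function `v`. -/
def HasH1Deriv {𝕂 : Type*} [RCLike 𝕂] {n : ℕ} {a b : ℝ} (u : ℝ → Vec 𝕂 n)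
    (v : L2 𝕂 n a b) : Prop :=
  ∀ ζ ∈ Icc a b, u ζ = u a + ∫ s in a..ζ, v s

/-- `A x = y`: the function `H x` belongs to `H¹` (`u` is its absolutely continuous representative
and `v` its derivative), it satisfies the boundary condition, and `y = P₁ (H x)' + P₀ (H x)`. -/
def System.GraphRel {𝕂 : Type*} [RCLike 𝕂] {n : ℕ} (Q : System n) {a b : ℝ}
    (x y : L2 𝕂 n a b) : Prop :=
  ∃ (u : ℝ → Vec 𝕂 n) (v : L2 𝕂 n a b),
    (∀ᵐ ζ ∂(volume.restrict (Icc a b)), u ζ = act 𝕂 (Q.H ζ) (x ζ)) ∧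
    HasH1Deriv u v ∧
    Q.BoundaryCondition (u b) (u a) ∧
    (∀ᵐ ζ ∂(volume.restrict (Icc a b)), y ζ = act 𝕂 Q.P₁ (v ζ) + act 𝕂 Q.P₀ (u ζ))

section Helpers

variable {𝕂 : Type*} [RCLike 𝕂] {n : ℕ} {a b : ℝ}

theorem L2.integrable (v : L2 𝕂 n a b) : Integrable v (volume.restrict (Icc a b)) :=
  (Lp.memLp v).integrable (by norm_num)

theorem L2.intervalIntegrable (v : L2 𝕂 n a b) {ζ : ℝ} (hζ : ζ ∈ Icc a b) :
    IntervalIntegrable v volume a ζ := by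
  rw [intervalIntegrable_iff_integrableOn_Ioc_of_le hζ.1]
  have hsub : Ioc a ζ ⊆ Icc a b := fun s hs => ⟨hs.1.le, hs.2.trans hζ.2⟩
  exact IntegrableOn.mono_set (t := Icc a b) (L2.integrable v) hsub

theorem integral_congr_of_ae {f g : ℝ → Vec 𝕂 n} {ζ : ℝ} (hζ : ζ ∈ Icc a b)
    (h : f =ᵐ[volume.restrict (Icc a b)] g) : ∫ s in a..ζ, f s = ∫ s in a..ζ, g s := by
  rw [intervalIntegral.integral_of_le hζ.1, intervalIntegral.integral_of_le hζ.1]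
  have hsub : Ioc a ζ ⊆ Icc a b := fun s hs => ⟨hs.1.le, hs.2.trans hζ.2⟩
  exact integral_congr_ae (ae_restrict_of_ae_restrict_of_subset hsub h)

theorem HasH1Deriv.add {u u' : ℝ → Vec 𝕂 n} {v v' : L2 𝕂 n a b} (h : HasH1Deriv u v)
    (h' : HasH1Deriv u' v') : HasH1Deriv (u + u') (v + v') := by
  intro ζ hζ
  rw [integral_congr_of_ae hζ (Lp.coeFn_add v v')]
  simp only [Pi.add_apply]
  rw [intervalIntegral.integral_add (v.intervalIntegrable hζ) (v'.intervalIntegrable hζ),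
    h ζ hζ, h' ζ hζ]
  abel

theorem HasH1Deriv.smul {u : ℝ → Vec 𝕂 n} {v : L2 𝕂 n a b} (c : 𝕂) (h : HasH1Deriv u v) :
    HasH1Deriv (c • u) (c • v) := by
  intro ζ hζ
  rw [integral_congr_of_ae hζ (Lp.coeFn_smul c v)]
  simp only [Pi.smul_apply]
  rw [intervalIntegral.integral_smul, h ζ hζ, smul_add]

theorem HasH1Deriv.continuousOn {u : ℝ → Vec 𝕂 n} {v : L2 𝕂 n a b} (h : HasH1Deriv u v) :
    ContinuousOn u (Icc a b) := by
  have hv : IntegrableOn v (Icc a b) := L2.integrable v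
  have h1 : ContinuousOn (fun ζ => u a + ∫ s in a..ζ, v s) (Icc a b) := by
    refine continuousOn_const.add ?_
    rcases le_or_gt a b with hab | hab
    · have hu := uIcc_of_le hab
      refine (intervalIntegral.continuousOn_primitive_interval (a := a) (b := b) (f := v)
        (μ := volume) ?_).mono hu.ge
      exact hv.mono_set hu.le
    · simp [Icc_eq_empty_of_lt hab]
  exact h1.congr h

theorem HasH1Deriv.eq_zero (hab : a < b) {u : ℝ → Vec 𝕂 n} {v : L2 𝕂 n a b}
    (h : HasH1Deriv u v) (hu : ∀ᵐ ζ ∂(volume.restrict (Icc a b)), u ζ = 0) :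
    (∀ ζ ∈ Icc a b, u ζ = 0) ∧ v = 0 := by
  have h0 : EqOn u 0 (Icc a b) :=
    Measure.eqOn_Icc_of_ae_eq (μ := volume) hab.ne hu h.continuousOn continuousOn_const
  refine ⟨fun ζ hζ => h0 hζ, ?_⟩
  have hi : ∀ ζ ∈ Icc a b, ∫ s in a..ζ, v s = 0 := by
    intro ζ hζ
    have e := h ζ hζ
    rw [h0 hζ, h0 (left_mem_Icc.2 hab.le)] at e
    simpa using e.symm
  have hae := (v.intervalIntegrable (right_mem_Icc.2 hab.le)).ae_hasDerivAt_integral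
  apply Lp.ext
  refine Filter.EventuallyEq.trans ?_ (Lp.coeFn_zero (Vec 𝕂 n) 2 _).symm
  have hm : (volume : Measure ℝ).restrict (Icc a b) = volume.restrict (Ioo a b) :=
    (Measure.restrict_congr_set Ioo_ae_eq_Icc).symm
  suffices H : ∀ᵐ ζ ∂(volume.restrict (Ioo a b)), v ζ = 0 from
    H.filter_mono (ae_mono hm.le)
  refine (ae_restrict_iff' measurableSet_Ioo).2 ?_
  filter_upwards [hae] with ζ e hζ
  have hζ' : ζ ∈ Icc a b := Ioo_subset_Icc_self hζ
  have d1 := e (by rwa [uIcc_of_le hab.le]) a (by simp)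
  have d2 : HasDerivAt (fun t => ∫ s in a..t, v s) 0 ζ := by
    refine (hasDerivAt_const ζ (0 : Vec 𝕂 n)).congr_of_eventuallyEq ?_
    filter_upwards [Ioo_mem_nhds hζ.1 hζ.2] with t ht
    exact hi t (Ioo_subset_Icc_self ht)
  exact d1.unique d2

theorem System.BoundaryCondition.add {Q : System n} {p q p' q' : Vec 𝕂 n}
    (h : Q.BoundaryCondition p q) (h' : Q.BoundaryCondition p' q') :
    Q.BoundaryCondition (p + p') (q + q') := by
  unfold System.BoundaryCondition at *
  rw [← add_zero (0 : Fin n → 𝕂)]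
  nth_rewrite 1 [← h]
  rw [← h', ← Matrix.mulVec_add]
  congr 1
  ext i
  rcases i with i | i
  · simp [effort]; ring
  · simp [System.flow]; ring

theorem System.BoundaryCondition.smul {Q : System n} {p q : Vec 𝕂 n} (c : 𝕂)
    (h : Q.BoundaryCondition p q) : Q.BoundaryCondition (c • p) (c • q) := by
  unfold System.BoundaryCondition at *
  rw [← smul_zero c, ← h, ← Matrix.mulVec_smul]
  congr 1
  ext i
  rcases i with i | i
  · simp [effort]; ring
  · simp [System.flow]; ring

end Helpers

/-- The graph of the operator `A`. -/
def System.graph (𝕂 : Type*) [RCLike 𝕂] {n : ℕ} (Q : System n) (a b : ℝ) :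
    Submodule 𝕂 (L2 𝕂 n a b × L2 𝕂 n a b) where
  carrier := {z | Q.GraphRel z.1 z.2}
  zero_mem' := by
    refine ⟨0, 0, ?_, ?_, ?_, ?_⟩
    · filter_upwards [Lp.coeFn_zero (Vec 𝕂 n) 2 (volume.restrict (Icc a b))] with ζ h
      simp only [Prod.fst_zero, Prod.snd_zero, h, Pi.zero_apply, map_zero, add_zero]
    · intro ζ hζ
      rw [integral_congr_of_ae hζ (Lp.coeFn_zero (Vec 𝕂 n) 2 (volume.restrict (Icc a b)))]
      simp
    · unfold System.BoundaryCondition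
      rw [← Matrix.mulVec_zero (Q.W_B.map (algebraMap ℝ 𝕂))]
      congr 1
      ext i
      rcases i with i | i <;> simp [effort, System.flow]
    · filter_upwards [Lp.coeFn_zero (Vec 𝕂 n) 2 (volume.restrict (Icc a b))] with ζ h
      simp only [Prod.fst_zero, Prod.snd_zero, h, Pi.zero_apply, map_zero, add_zero]
  add_mem' := by
    rintro ⟨x, y⟩ ⟨x', y'⟩ ⟨u, v, h1, h2, h3, h4⟩ ⟨u', v', h1', h2', h3', h4'⟩
    refine ⟨u + u', v + v', ?_, h2.add h2', h3.add h3', ?_⟩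
    · filter_upwards [h1, h1', Lp.coeFn_add x x'] with ζ e1 e2 e3
      simp only [Prod.mk_add_mk, e3, Pi.add_apply, e1, e2, map_add]
    · filter_upwards [h4, h4', Lp.coeFn_add y y', Lp.coeFn_add v v'] with ζ e1 e2 e3 e4
      simp only [Prod.mk_add_mk, e3, e4, Pi.add_apply, e1, e2, map_add]
      abel
  smul_mem' := by
    rintro c ⟨x, y⟩ ⟨u, v, h1, h2, h3, h4⟩
    refine ⟨c • u, c • v, ?_, h2.smul c, h3.smul c, ?_⟩
    · filter_upwards [h1, Lp.coeFn_smul c x] with ζ e1 e3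
      simp [e1, e3]
    · filter_upwards [h4, Lp.coeFn_smul c y, Lp.coeFn_smul c v] with ζ e1 e3 e4
      simp [e3, e4, e1]

/-- The port-Hamiltonian operator `A = (P₁ ∂_ζ + P₀) H` in `L²([a,b], 𝕂ⁿ)`, with domain
`D(A) = {x | H x ∈ H¹, W_B (e_∂; f_∂) = 0}`. -/
noncomputable def System.op (𝕂 : Type*) [RCLike 𝕂] {n : ℕ} (Q : System n) (a b : ℝ) :
    L2 𝕂 n a b →ₗ.[𝕂] L2 𝕂 n a b :=
  (Q.graph 𝕂 a b).toLinearPMap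

theorem System.mem_op_graph_iff {𝕂 : Type*} [RCLike 𝕂] {n : ℕ} (Q : System n) {a b : ℝ}
    (hab : a < b) (x y : L2 𝕂 n a b) :
    (x, y) ∈ (Q.op 𝕂 a b).graph ↔ Q.GraphRel x y := by
  rw [System.op, Submodule.toLinearPMap_graph_eq]
  · rfl
  rintro ⟨x, y⟩ ⟨u, v, h1, h2, h3, h4⟩ rfl
  have hu : ∀ᵐ ζ ∂(volume.restrict (Icc a b)), u ζ = 0 := by
    filter_upwards [h1, Lp.coeFn_zero (Vec 𝕂 n) 2 (volume.restrict (Icc a b))] with ζ e1 e2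
    rw [e1]
    simp only [e2, Pi.zero_apply, map_zero]
  obtain ⟨-, rfl⟩ := h2.eq_zero hab hu
  apply Lp.ext
  filter_upwards [h4, hu, Lp.coeFn_zero (Vec 𝕂 n) 2 (volume.restrict (Icc a b))] with ζ e1 e2 e3
  rw [e1, e2, e3]
  simp only [Pi.zero_apply, map_zero, add_zero]

/-- A classical solution on `[0,∞)` of the abstract Cauchy problem `ẋ = A x`. -/
structure IsClassicalSolution {𝕂 X : Type*} [RCLike 𝕂] [NormedAddCommGroup X] [NormedSpace 𝕂 X]
    [NormedSpace ℝ X] (A : X →ₗ.[𝕂] X) (x : ℝ → X) : Prop where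
  contDiffOn : ContDiffOn ℝ 1 x (Ici 0)
  mem_domain : ∀ t, 0 ≤ t → x t ∈ A.domain
  hasDeriv : ∀ t (ht : 0 ≤ t), HasDerivWithinAt x (A ⟨x t, mem_domain t ht⟩) (Ici 0) t

/-- The squared energy norm `‖f‖²_𝓧 = ½ ∫ f* H f` of `f ∈ L²([a,b], 𝕂ⁿ)`. -/
noncomputable def System.energy {𝕂 : Type*} [RCLike 𝕂] {n : ℕ} (Q : System n) {a b : ℝ}
    (f : L2 𝕂 n a b) : ℝ :=
  (1 / 2) * ∫ ζ in Icc a b, quadForm 𝕂 (Q.H ζ) (f ζ)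

open Classical in
/-- The value at `δ ∈ [a,b]` of the continuous representative of `f ∈ L²([a,b], 𝕂ⁿ)`
(and `0` if `f` has none). -/
noncomputable def pointValue {𝕂 : Type*} [RCLike 𝕂] {n : ℕ} {a b : ℝ} (f : L2 𝕂 n a b)
    (δ : ℝ) : Vec 𝕂 n :=
  if h : ∃ w : ℝ → Vec 𝕂 n, ContinuousOn w (Icc a b) ∧
      f =ᵐ[volume.restrict (Icc a b)] w then h.choose δ else 0

theorem pointValue_eq {𝕂 : Type*} [RCLike 𝕂] {n : ℕ} {a b : ℝ} (hab : a < b) {f : L2 𝕂 n a b}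
    {w : ℝ → Vec 𝕂 n} (hw : ContinuousOn w (Icc a b))
    (hf : f =ᵐ[volume.restrict (Icc a b)] w) {δ : ℝ} (hδ : δ ∈ Icc a b) :
    pointValue f δ = w δ := by
  have h : ∃ w : ℝ → Vec 𝕂 n, ContinuousOn w (Icc a b) ∧
      f =ᵐ[volume.restrict (Icc a b)] w := ⟨w, hw, hf⟩
  rw [pointValue, dif_pos h]
  exact Measure.eqOn_Icc_of_ae_eq (μ := volume) hab.ne (h.choose_spec.2.symm.trans hf)
    h.choose_spec.1 hw hδ

/-- The energy density `(x* H x)(t, δ)` of a trajectory `x` at time `t` and position `δ`. -/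
noncomputable def System.density {𝕂 : Type*} [RCLike 𝕂] {n : ℕ} (Q : System n) {a b : ℝ}
    (x : ℝ → L2 𝕂 n a b) (t δ : ℝ) : ℝ :=
  quadForm 𝕂 (Q.H δ) (pointValue (x t) δ)

end PortHam

/-!
Write `u = H x` and let `w` be the continuous representative of `x`, so that
`∂ₜ w = P₁ ∂_ζ u + P₀ u` with `u = H w`. The proof exchanges the roles of time and space. The density
`q = w* H w` satisfies `∂_ζ q = ∂ₜ p + r` with `p = w* P₁⁻¹ w` and a zeroth-order remainder
`|r| ≤ C q`, and `γ H ≥ ± P₁⁻¹` says precisely that `|p| ≤ γ q`. Hence `q` propagates in the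
direction of `ζ` with speed at most `γ`: the integral of `q(·, ζ₁)` over a time window is at most
`exp (C |ζ₂ - ζ₁|)` times that of `q(·, ζ₂)` over the window enlarged by `γ |ζ₂ - ζ₁|` on both
sides (`cone_estimate`, `IsMildField.sideways`). The boundary condition is dissipative
(`inner_nonpos_of_boundary`), so the energy `½ ∫ q dζ` decreases in time
(`IsMildField.antitoneOn_energy`). Averaging the sideways estimate over its starting point, and
bounding the energy from below by its final value, gives `IsMildField.energy_le_observation`;
averaging over its end point, and bounding the energy from above by its initial value, gives
`IsMildField.observation_le_energy`.

A classical solution is differentiable in time only as an `L²`-valued map, so these identities do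
not make sense pointwise. The graph norm of the operator controls the supremum of `H x`, which makes
`w` jointly continuous (`System.Admissible.continuous_rep`), and `w` solves the equation integrated
in time and space (`IsClassicalSolution.exists_mildField`). The Steklov averages
`h⁻¹ ∫_t^{t+h} w(s, ζ) ds` then satisfy the equation pointwise, with continuous derivatives
(`IsMildField.smooth_steklov`); both estimates hold for them with constants independent of `h` and
pass to the limit `h → 0`.

All of this takes place in `𝕂ⁿ` regarded as a real inner product space.
-/

namespace PortHam

open MeasureTheory Set Filter Topology Function
open scoped InnerProductSpace

/-! ### Two energy estimates for scalar densities -/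

/-- Differentiation under the integral sign when the derivative is jointly continuous and the
differentiability is only known over the interior of the interval of integration. -/
theorem hasDerivAt_intervalIntegral_of_continuous {E : Type*} [NormedAddCommGroup E]
    [NormedSpace ℝ E] {f f' : ℝ → ℝ → E} {a b x₀ : ℝ} {s : Set ℝ} (hab : a ≤ b) (hs : s ∈ 𝓝 x₀)
    (hf : ∀ x, Continuous (f x)) (hf' : Continuous (uncurry f'))
    (hd : ∀ x ∈ s, ∀ y ∈ Ioo a b, HasDerivAt (fun z => f z y) (f' x y) x) :
    HasDerivAt (fun x => ∫ y in a..b, f x y) (∫ y in a..b, f' x₀ y) x₀ := by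
  obtain ⟨C, hC⟩ := ((isCompact_closedBall x₀ (1 : ℝ)).prod
    (isCompact_Icc (a := a) (b := b))).exists_bound_of_continuousOn hf'.continuousOn
  refine (intervalIntegral.hasDerivAt_integral_of_dominated_loc_of_deriv_le (bound := fun _ => C)
    (s := s ∩ Metric.closedBall x₀ 1)
    (inter_mem hs (Metric.closedBall_mem_nhds x₀ one_pos)) ?_
    ((hf x₀).intervalIntegrable a b) ?_ ?_ intervalIntegrable_const ?_).2
  · exact Eventually.of_forall fun x => (hf x).aestronglyMeasurable
  · exact (hf'.comp (Continuous.prodMk_right x₀)).aestronglyMeasurable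
  · refine Eventually.of_forall fun y hy x hx => hC (x, y) ⟨hx.2, ?_⟩
    rw [uIoc_of_le hab] at hy
    exact Ioc_subset_Icc_self hy
  · have hb : ∀ᵐ y ∂(volume : Measure ℝ), y ≠ b := by simp [ae_iff]
    filter_upwards [hb] with y hyb hy x hx
    rw [uIoc_of_le hab] at hy
    exact hd x hx.1 y ⟨hy.1, lt_of_le_of_ne hy.2 hyb⟩

/-- If an energy density `e` with flux `f` satisfies `∂ₜ e = ∂_ζ f` and the flux does not increase
from `a` to `b`, then the total energy decreases in time. -/
theorem antitoneOn_integral_of_flux {e e' f : ℝ → ℝ → ℝ} {a b : ℝ} (hab : a ≤ b)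
    (he : Continuous (uncurry e)) (he' : Continuous (uncurry e'))
    (hf : ∀ t, Continuous (f t))
    (het : ∀ t > 0, ∀ ζ ∈ Ioo a b, HasDerivAt (fun r => e r ζ) (e' t ζ) t)
    (hfz : ∀ t > 0, ∀ ζ ∈ Ioo a b, HasDerivAt (f t) (e' t ζ) ζ)
    (hflux : ∀ t > 0, f t b ≤ f t a) :
    AntitoneOn (fun t => ∫ ζ in a..b, e t ζ) (Ici 0) := by
  have hd : ∀ t > 0, HasDerivAt (fun t => ∫ ζ in a..b, e t ζ) (f t b - f t a) t := by
    intro t ht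
    have h1 := hasDerivAt_intervalIntegral_of_continuous hab (Ioi_mem_nhds ht)
      (fun x => he.comp (Continuous.prodMk_right x)) he' het
    rwa [intervalIntegral.integral_eq_sub_of_hasDerivAt_of_le hab (hf t).continuousOn
      (hfz t ht) ((he'.comp (Continuous.prodMk_right t)).intervalIntegrable a b)] at h1
  refine antitoneOn_of_deriv_nonpos (convex_Ici 0) ?_ ?_ ?_
  · exact (intervalIntegral.continuous_parametric_intervalIntegral_of_continuous' he a
      b).continuousOn
  · intro t ht
    rw [interior_Ici] at ht
    exact (hd t ht).differentiableAt.differentiableWithinAt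
  · intro t ht
    rw [interior_Ici] at ht
    rw [(hd t ht).deriv]
    linarith [hflux t ht]

/-- The chain rule along a curve for a function of two real variables with continuous partial
derivatives. -/
theorem hasDerivAt_comp_of_partial {q q₁ q₂ : ℝ → ℝ → ℝ} {U : Set (ℝ × ℝ)} (hU : IsOpen U)
    (h₁ : Continuous (uncurry q₁)) (h₂ : Continuous (uncurry q₂))
    (hd₁ : ∀ v ∈ U, HasDerivAt (fun t => q t v.2) (q₁ v.1 v.2) v.1)
    (hd₂ : ∀ v ∈ U, HasDerivAt (fun z => q v.1 z) (q₂ v.1 v.2) v.2)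
    {c d : ℝ → ℝ} {c' d' r : ℝ} (hc : HasDerivAt c c' r) (hd : HasDerivAt d d' r)
    (hr : (c r, d r) ∈ U) :
    HasDerivAt (fun r => q (c r) (d r)) (c' * q₁ (c r) (d r) + d' * q₂ (c r) (d r)) r := by
  have hm : U ∈ 𝓝 (c r, d r) := hU.mem_nhds hr
  have hcont : ∀ g : ℝ → ℝ → ℝ, Continuous (uncurry g) →
      Continuous (fun v : ℝ × ℝ => ContinuousLinearMap.toSpanSingleton ℝ (g v.1 v.2)) := by
    intro g hg
    have h : (fun v : ℝ × ℝ => ContinuousLinearMap.toSpanSingleton ℝ (g v.1 v.2)) =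
        fun v => uncurry g v • ContinuousLinearMap.toSpanSingleton ℝ (1 : ℝ) := by
      ext v
      simp [uncurry]
    rw [h]
    exact hg.smul continuous_const
  have hs := hasStrictFDerivAt_uncurry_coprod (𝕜 := ℝ) (u := (c r, d r)) (f := q)
    (f₁ := fun t z => ContinuousLinearMap.toSpanSingleton ℝ (q₁ t z))
    (f₂ := fun t z => ContinuousLinearMap.toSpanSingleton ℝ (q₂ t z))
    (by filter_upwards [hm] with v hv using (hd₁ v hv).hasFDerivAt)
    (by filter_upwards [hm] with v hv using (hd₂ v hv).hasFDerivAt)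
    (hcont q₁ h₁).continuousAt (hcont q₂ h₂).continuousAt
  have := hs.hasFDerivAt.comp_hasDerivAt r (hc.prodMk hd)
  simpa [HasUncurry.uncurry, Function.comp_def] using this

/-- Sideways energy estimate. Regard `ζ` as the evolution variable of the density `q`, with flux
`-p`, and let the time window grow at speed `γ` while `ζ` moves from `ζ₁` to `ζ₂`. Since
`|p| ≤ γ q`, nothing leaves through the sides of this trapezoid, so the integral of `q` over the
window can only decay through the source `∂_ζ q - ∂ₜ p = O(q)`. -/
theorem cone_estimate {q q₁ q₂ p p₁ : ℝ → ℝ → ℝ} {a b γ C : ℝ} (hγ : 0 < γ)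
    (hq : Continuous (uncurry q)) (hq₁ : Continuous (uncurry q₁)) (hq₂ : Continuous (uncurry q₂))
    (hp₁ : Continuous (uncurry p₁))
    (hdq₁ : ∀ t > 0, ∀ ζ ∈ Ioo a b, HasDerivAt (fun r => q r ζ) (q₁ t ζ) t)
    (hdq₂ : ∀ t > 0, ∀ ζ ∈ Ioo a b, HasDerivAt (q t) (q₂ t ζ) ζ)
    (hdp₁ : ∀ t > 0, ∀ ζ ∈ Ioo a b, HasDerivAt (fun r => p r ζ) (p₁ t ζ) t)
    (hsource : ∀ t > 0, ∀ ζ ∈ Ioo a b, |q₂ t ζ - p₁ t ζ| ≤ C * q t ζ)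
    (hpq : ∀ t > 0, ∀ ζ ∈ Ioo a b, |p t ζ| ≤ γ * q t ζ)
    {ζ₁ ζ₂ s t : ℝ} (hζ₁ : ζ₁ ∈ Icc a b) (hζ₂ : ζ₂ ∈ Icc a b) (hst : s ≤ t)
    (hs : 0 ≤ s - γ * |ζ₂ - ζ₁|) :
    ∫ r in s..t, q r ζ₁ ≤
      Real.exp (C * |ζ₂ - ζ₁|) * ∫ r in (s - γ * |ζ₂ - ζ₁|)..(t + γ * |ζ₂ - ζ₁|), q r ζ₂ := by
  rcases eq_or_ne ζ₁ ζ₂ with rfl | hne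
  · simp
  set R := |ζ₂ - ζ₁| with hR
  have hR0 : 0 < R := abs_pos.2 (sub_ne_zero.2 hne.symm)
  obtain ⟨ε, hε, hεR⟩ : ∃ ε : ℝ, (ε = 1 ∨ ε = -1) ∧ ζ₂ = ζ₁ + ε * R := by
    rcases abs_choice (ζ₂ - ζ₁) with h | h
    · exact ⟨1, Or.inl rfl, by rw [hR, h]; ring⟩
    · exact ⟨-1, Or.inr rfl, by rw [hR, h]; ring⟩
  -- `G r` is the integral of `q` over the window reached after moving by `r`, rescaled to `[-1,1]`;
  -- the window has centre `c` and half-length `l r`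
  set c := (s + t) / 2 with hc
  set l : ℝ → ℝ := fun r => (t - s) / 2 + γ * r with hl
  have hlc : Continuous l := by fun_prop
  have hld : ∀ r, HasDerivAt l γ r := fun r => by
    simpa only [mul_one, id] using ((hasDerivAt_id r).const_mul γ).const_add ((t - s) / 2)
  set G : ℝ → ℝ := fun r => ∫ ρ in (-1 : ℝ)..1, l r * q (c + l r * ρ) (ζ₁ + ε * r) with hG
  have hGeq : ∀ r, G r = ∫ x in (s - γ * r)..(t + γ * r), q x (ζ₁ + ε * r) := by
    intro r
    rw [hG]
    simp only [intervalIntegral.integral_const_mul]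
    rw [intervalIntegral.mul_integral_comp_add_mul (f := fun x => q x (ζ₁ + ε * r))]
    congr 1 <;> simp only [hc, hl] <;> ring
  have hint : ∀ r ∈ Ioo 0 R, ζ₁ + ε * r ∈ Ioo a b := by
    intro r hr
    rw [hεR] at hζ₂
    rcases hε with rfl | rfl
    · constructor <;> linarith [hr.1, hr.2, hζ₁.1, hζ₁.2, hζ₂.1, hζ₂.2]
    · constructor <;> linarith [hr.1, hr.2, hζ₁.1, hζ₁.2, hζ₂.1, hζ₂.2]
  have hl0 : ∀ r ∈ Ioo 0 R, 0 < l r := fun r hr => by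
    have := mul_pos hγ hr.1
    simp only [hl]; linarith
  have htime : ∀ r ∈ Ioo 0 R, ∀ ρ ∈ Icc (-1 : ℝ) 1, 0 < c + l r * ρ := by
    intro r hr ρ hρ
    have h1 := mul_le_mul_of_nonneg_left hρ.1 (hl0 r hr).le
    have h2 := mul_lt_mul_of_pos_left hr.2 hγ
    simp only [hl, hc] at h1 ⊢
    linarith
  set G' : ℝ → ℝ → ℝ := fun r ρ => γ * q (c + l r * ρ) (ζ₁ + ε * r) +
    l r * (γ * ρ * q₁ (c + l r * ρ) (ζ₁ + ε * r) + ε * q₂ (c + l r * ρ) (ζ₁ + ε * r)) with hG'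
  have hcomp : ∀ g : ℝ → ℝ → ℝ, Continuous (uncurry g) →
      Continuous (fun z : ℝ × ℝ => g (c + l z.1 * z.2) (ζ₁ + ε * z.1)) := by
    intro g hg
    have : Continuous fun z : ℝ × ℝ => (c + l z.1 * z.2, ζ₁ + ε * z.1) := by fun_prop
    exact hg.comp this
  have hcomp' : ∀ g : ℝ → ℝ → ℝ, Continuous (uncurry g) → ∀ r,
      Continuous (fun ρ : ℝ => g (c + l r * ρ) (ζ₁ + ε * r)) := fun g hg r =>
    (hcomp g hg).comp (Continuous.prodMk_right r)
  have hGcont : Continuous G := by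
    refine intervalIntegral.continuous_parametric_intervalIntegral_of_continuous' ?_ _ _
    have := hcomp q hq
    change Continuous fun z : ℝ × ℝ => l z.1 * q (c + l z.1 * z.2) (ζ₁ + ε * z.1)
    fun_prop
  have hG'cont : Continuous (uncurry G') := by
    have h0 := hcomp q hq
    have h1 := hcomp q₁ hq₁
    have h2 := hcomp q₂ hq₂
    change Continuous fun z : ℝ × ℝ => G' z.1 z.2
    simp only [hG']
    fun_prop
  have hGd : ∀ r ∈ Ioo 0 R, HasDerivAt G (∫ ρ in (-1 : ℝ)..1, G' r ρ) r := by
    intro r hr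
    refine hasDerivAt_intervalIntegral_of_continuous (by norm_num) (Ioo_mem_nhds hr.1 hr.2)
      (fun x => continuous_const.mul (hcomp' q hq x)) hG'cont ?_
    intro x hx ρ hρ
    have hρ' := Ioo_subset_Icc_self hρ
    have hd1 : HasDerivAt (fun x => c + l x * ρ) (γ * ρ) x := ((hld x).mul_const ρ).const_add c
    have hd2 : HasDerivAt (fun x => ζ₁ + ε * x) ε x := by
      simpa using ((hasDerivAt_id x).const_mul ε).const_add ζ₁
    have h := (hld x).mul (hasDerivAt_comp_of_partial (isOpen_Ioi.prod isOpen_Ioo) hq₁ hq₂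
      (fun v hv => hdq₁ v.1 hv.1 v.2 hv.2) (fun v hv => hdq₂ v.1 hv.1 v.2 hv.2) hd1 hd2
      ⟨htime x hx ρ hρ', hint x hx⟩)
    exact h
  -- both end-point contributions are nonnegative because `|p| ≤ γ q`
  have hGder : ∀ r ∈ Ioo 0 R, -(C * G r) ≤ ∫ ρ in (-1 : ℝ)..1, G' r ρ := by
    intro r hr
    set z := ζ₁ + ε * r with hz
    have hzI := hint r hr
    -- the part of `G'` that is an exact derivative in the rescaled time `ρ`
    have hftc : ∫ ρ in (-1 : ℝ)..1, (γ * q (c + l r * ρ) z + γ * ρ * (l r * q₁ (c + l r * ρ) z) +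
        ε * (l r * p₁ (c + l r * ρ) z)) =
        (γ * 1 * q (c + l r * 1) z + ε * p (c + l r * 1) z) -
        (γ * (-1) * q (c + l r * (-1)) z + ε * p (c + l r * (-1)) z) := by
      refine intervalIntegral.integral_eq_sub_of_hasDerivAt
        (f := fun ρ => γ * ρ * q (c + l r * ρ) z + ε * p (c + l r * ρ) z) ?_ ?_
      · intro ρ hρ
        rw [uIcc_of_le (by norm_num)] at hρ
        have ht := htime r hr ρ hρ
        have hd1 : HasDerivAt (fun ρ => c + l r * ρ) (l r) ρ := by
          simpa using ((hasDerivAt_id ρ).const_mul (l r)).const_add c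
        have hqd := (hdq₁ _ ht z hzI).comp ρ hd1
        have hpd := (hdp₁ _ ht z hzI).comp ρ hd1
        have hlin : HasDerivAt (fun ρ => γ * ρ) γ ρ := by
          simpa using (hasDerivAt_id ρ).const_mul γ
        have h := (hlin.mul hqd).add (hpd.const_mul ε)
        refine h.congr_deriv ?_
        simp only [Function.comp_apply]
        ring
      · have h0 := hcomp' q hq r
        have h1 := hcomp' q₁ hq₁ r
        have h2 := hcomp' p₁ hp₁ r
        apply Continuous.intervalIntegrable
        fun_prop
    have hle : (∫ ρ in (-1 : ℝ)..1, (γ * q (c + l r * ρ) z +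
        γ * ρ * (l r * q₁ (c + l r * ρ) z) + ε * (l r * p₁ (c + l r * ρ) z))) - C * G r ≤
        ∫ ρ in (-1 : ℝ)..1, G' r ρ := by
      have h0 := hcomp' q hq r
      have h1 := hcomp' q₁ hq₁ r
      have h2 := hcomp' p₁ hp₁ r
      simp only [hG]
      rw [← intervalIntegral.integral_const_mul, ← intervalIntegral.integral_sub]
      · refine intervalIntegral.integral_mono_on (by norm_num) ?_ ?_ ?_
        · apply Continuous.intervalIntegrable
          fun_prop
        · exact (hG'cont.comp (Continuous.prodMk_right r)).intervalIntegrable _ _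
        · intro ρ hρ
          have hsrc := hsource _ (htime r hr ρ hρ) z hzI
          have hsrc' : -(C * q (c + l r * ρ) z) ≤
              ε * (q₂ (c + l r * ρ) z - p₁ (c + l r * ρ) z) := by
            rw [abs_le] at hsrc
            rcases hε with h | h <;> rw [h] <;> linarith [hsrc.1, hsrc.2]
          have := mul_le_mul_of_nonneg_left hsrc' (hl0 r hr).le
          simp only [hG', ← hz]
          nlinarith
      · apply Continuous.intervalIntegrable
        fun_prop
      · apply Continuous.intervalIntegrable
        fun_prop
    rw [hftc] at hle
    have hp1 := hpq _ (htime r hr 1 (by norm_num)) z hzI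
    have hp2 := hpq _ (htime r hr (-1) (by norm_num)) z hzI
    rw [abs_le] at hp1 hp2
    refine le_trans ?_ hle
    rcases hε with h | h <;> rw [h] <;> linarith [hp1.1, hp1.2, hp2.1, hp2.2]
  have hmono : MonotoneOn (fun r => Real.exp (C * r) * G r) (Icc 0 R) := by
    have hd : ∀ r ∈ Ioo 0 R, HasDerivAt (fun r => Real.exp (C * r) * G r)
        (Real.exp (C * r) * C * G r + Real.exp (C * r) * ∫ ρ in (-1 : ℝ)..1, G' r ρ) r := by
      intro r hr
      have : HasDerivAt (fun r => Real.exp (C * r)) (Real.exp (C * r) * C) r := by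
        simpa using ((hasDerivAt_id r).const_mul C).exp
      exact this.mul (hGd r hr)
    refine monotoneOn_of_deriv_nonneg (convex_Icc 0 R) (by fun_prop) ?_ ?_
    · rw [interior_Icc]
      exact fun r hr => (hd r hr).differentiableAt.differentiableWithinAt
    · rw [interior_Icc]
      intro r hr
      rw [(hd r hr).deriv]
      have := mul_le_mul_of_nonneg_left (hGder r hr) (Real.exp_pos (C * r)).le
      linarith
  have h := hmono (left_mem_Icc.2 hR0.le) (right_mem_Icc.2 hR0.le) hR0.le
  simp only [hGeq, ← hεR] at h
  simpa using h

/-! ### Continuous fields and their time averages -/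

section Fields

variable {V Z : Type*} [NormedAddCommGroup V] [InnerProductSpace ℝ V] [NormedAddCommGroup Z]
  [NormedSpace ℝ Z]

/-- Coefficients of the equation `∂ₜ w = P₁ ∂_ζ (H w) + P₀ H w` on `[a,b]` with values in a real
inner product space, together with the boundary operator `L`, which acts on the pair of values of
`H w` at `b` and at `a`. Here `R = P₁⁻¹` and `H'` is the derivative of `H`; the functions `H` and
`H'` are defined and continuous on all of `ℝ`, but `H'` is the derivative of `H` on `(a,b)` only. -/
structure Coefficients (a b γ m : ℝ) (H H' : ℝ → V →L[ℝ] V) (P₁ P₀ R : V →L[ℝ] V)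
    (L : V × V →L[ℝ] Z) : Prop where
  H_cont : Continuous H
  H'_cont : Continuous H'
  H_deriv : ∀ ζ ∈ Ioo a b, HasDerivAt H (H' ζ) ζ
  H_symm : ∀ ζ x y, ⟪H ζ x, y⟫_ℝ = ⟪x, H ζ y⟫_ℝ
  m_pos : 0 < m
  H_coercive : ∀ ζ x, m * ‖x‖ ^ 2 ≤ ⟪x, H ζ x⟫_ℝ
  P₁_symm : ∀ x y, ⟪P₁ x, y⟫_ℝ = ⟪x, P₁ y⟫_ℝ
  R_symm : ∀ x y, ⟪R x, y⟫_ℝ = ⟪x, R y⟫_ℝ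
  R_P₁ : ∀ x, R (P₁ x) = x
  P₁_R : ∀ x, P₁ (R x) = x
  P₀_skew : ∀ x, ⟪P₀ x, x⟫_ℝ = 0
  γ_pos : 0 < γ
  cone : ∀ ζ x, |⟪x, R x⟫_ℝ| ≤ γ * ⟪x, H ζ x⟫_ℝ
  dissipative : ∀ x y, L (x, y) = 0 → ⟪x, P₁ x⟫_ℝ ≤ ⟪y, P₁ y⟫_ℝ

/-- A jointly continuous field that solves the equation on `[0,∞) × [a,b]` in the sense obtained by
integrating it in both variables, with the boundary condition `L = 0`. -/
structure IsMildField (a b : ℝ) (H : ℝ → V →L[ℝ] V) (P₁ P₀ : V →L[ℝ] V) (L : V × V →L[ℝ] Z)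
    (w : ℝ → ℝ → V) : Prop where
  cont : Continuous (uncurry w)
  evol : ∀ t₁ t₂, 0 ≤ t₁ → t₁ ≤ t₂ → ∀ ζ ∈ Icc a b, ∫ s in a..ζ, (w t₂ s - w t₁ s) =
    ∫ t in t₁..t₂, (P₁ (H ζ (w t ζ) - H a (w t a)) + P₀ (∫ s in a..ζ, H s (w t s)))
  bc : ∀ t, 0 ≤ t → L (H b (w t b), H a (w t a)) = 0

/-- A jointly continuous field that solves the equation pointwise: it has the continuous time
derivative `w'`, and `H w` is differentiable in space. -/
structure IsSmoothField (a b : ℝ) (H : ℝ → V →L[ℝ] V) (P₀ R : V →L[ℝ] V)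
    (L : V × V →L[ℝ] Z) (w w' : ℝ → ℝ → V) : Prop where
  cont : Continuous (uncurry w)
  cont' : Continuous (uncurry w')
  deriv_time : ∀ t > 0, ∀ ζ ∈ Ioo a b, HasDerivAt (fun r => w r ζ) (w' t ζ) t
  deriv_space : ∀ t > 0, ∀ ζ ∈ Ioo a b,
    HasDerivAt (fun z => H z (w t z)) (R (w' t ζ - P₀ (H ζ (w t ζ)))) ζ
  bc : ∀ t, 0 ≤ t → L (H b (w t b), H a (w t a)) = 0

variable {a b γ m : ℝ} {H H' : ℝ → V →L[ℝ] V} {P₁ P₀ R : V →L[ℝ] V} {L : V × V →L[ℝ] Z}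
  {w w' : ℝ → ℝ → V}

theorem Coefficients.nonneg (hK : Coefficients a b γ m H H' P₁ P₀ R L) (ζ : ℝ) (x : V) :
    0 ≤ ⟪x, H ζ x⟫_ℝ :=
  (mul_nonneg hK.m_pos.le (sq_nonneg _)).trans (hK.H_coercive ζ x)

/-- The zeroth-order terms are controlled by the energy density, uniformly in space. -/
theorem Coefficients.exists_source_bound (hK : Coefficients a b γ m H H' P₁ P₀ R L) :
    ∃ C, 0 ≤ C ∧ ∀ ζ ∈ Icc a b, ∀ x,
      |2 * ⟪x, R (P₀ (H ζ x))⟫_ℝ + ⟪x, H' ζ x⟫_ℝ| ≤ C * ⟪x, H ζ x⟫_ℝ := by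
  have hc : Continuous fun ζ => 2 * (‖R‖ * (‖P₀‖ * ‖H ζ‖)) + ‖H' ζ‖ := by
    have := hK.H_cont
    have := hK.H'_cont
    fun_prop
  obtain ⟨C, hC⟩ := (isCompact_Icc (a := a) (b := b)).exists_bound_of_continuousOn hc.continuousOn
  refine ⟨max C 0 / m, by have := hK.m_pos; positivity, fun ζ hζ x => ?_⟩
  have h1 : ‖R (P₀ (H ζ x))‖ ≤ ‖R‖ * (‖P₀‖ * (‖H ζ‖ * ‖x‖)) :=
    R.le_opNorm_of_le (P₀.le_opNorm_of_le ((H ζ).le_opNorm x))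
  have h2 : ‖H' ζ x‖ ≤ ‖H' ζ‖ * ‖x‖ := (H' ζ).le_opNorm x
  have h3 := (abs_real_inner_le_norm x (R (P₀ (H ζ x)))).trans
    (mul_le_mul_of_nonneg_left h1 (norm_nonneg x))
  have h4 := (abs_real_inner_le_norm x (H' ζ x)).trans
    (mul_le_mul_of_nonneg_left h2 (norm_nonneg x))
  have h5 : 2 * (‖R‖ * (‖P₀‖ * ‖H ζ‖)) + ‖H' ζ‖ ≤ max C 0 :=
    (le_abs_self _).trans ((hC ζ hζ).trans (le_max_left _ _))
  have h6 := mul_le_mul_of_nonneg_right h5 (sq_nonneg ‖x‖)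
  have h7 := mul_le_mul_of_nonneg_left (hK.H_coercive ζ x) (le_max_right C 0)
  have h8 := abs_add_le (2 * ⟪x, R (P₀ (H ζ x))⟫_ℝ) ⟪x, H' ζ x⟫_ℝ
  rw [abs_mul, abs_two] at h8
  rw [div_mul_eq_mul_div, le_div_iff₀ hK.m_pos]
  have h9 : |2 * ⟪x, R (P₀ (H ζ x))⟫_ℝ + ⟪x, H' ζ x⟫_ℝ| ≤ max C 0 * ‖x‖ ^ 2 := by
    nlinarith
  have h10 := mul_le_mul_of_nonneg_right h9 hK.m_pos.le
  linarith

/-- The derivative of `⟪w, H w⟫` only needs `w` to be continuous, when `H w` and `H` are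
differentiable. -/
theorem hasDerivAt_inner_of_hasDerivAt_apply {H : ℝ → V →L[ℝ] V} {H' : V →L[ℝ] V} {w : ℝ → V}
    {u' : V} {ζ : ℝ} (hsymm : ∀ z x y, ⟪H z x, y⟫_ℝ = ⟪x, H z y⟫_ℝ) (hw : ContinuousAt w ζ)
    (hH : HasDerivAt H H' ζ) (hu : HasDerivAt (fun z => H z (w z)) u' ζ) :
    HasDerivAt (fun z => ⟪w z, H z (w z)⟫_ℝ) (2 * ⟪w ζ, u'⟫_ℝ - ⟪w ζ, H' (w ζ)⟫_ℝ) ζ := by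
  have hHw : HasDerivAt (fun z => H z (w ζ)) (H' (w ζ)) ζ := by
    simpa using hH.clm_apply (hasDerivAt_const ζ (w ζ))
  rw [hasDerivAt_iff_tendsto_slope] at hu hHw ⊢
  have hw' : Tendsto w (𝓝[≠] ζ) (𝓝 (w ζ)) := hw.tendsto.mono_left nhdsWithin_le_nhds
  have hlim := ((hw'.inner (𝕜 := ℝ) hu).add (hu.inner (𝕜 := ℝ) (tendsto_const_nhds (x := w ζ)))).sub
    (hw'.inner (𝕜 := ℝ) hHw)
  rw [real_inner_comm (w ζ) u', ← two_mul] at hlim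
  refine hlim.congr fun z => ?_
  simp only [slope_def_module, inner_smul_left, inner_smul_right, smul_eq_mul, inner_sub_left,
    inner_sub_right, RCLike.conj_to_real]
  rw [hsymm z (w z) (w ζ), hsymm ζ (w ζ) (w ζ), real_inner_comm (H ζ (w ζ)) (w z)]
  ring

theorem continuous_field_apply (hH : Continuous H) (hw : Continuous (uncurry w)) :
    Continuous fun z : ℝ × ℝ => H z.2 (w z.1 z.2) :=
  (hH.comp continuous_snd).clm_apply hw

theorem continuous_density (hH : Continuous H) (hw : Continuous (uncurry w)) :
    Continuous (uncurry fun t ζ => ⟪w t ζ, H ζ (w t ζ)⟫_ℝ) :=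
  hw.inner (𝕜 := ℝ) (continuous_field_apply hH hw)

theorem continuous_density_time (hH : Continuous H) (hw : Continuous (uncurry w)) (ζ : ℝ) :
    Continuous fun t => ⟪w t ζ, H ζ (w t ζ)⟫_ℝ :=
  (continuous_density hH hw).comp (Continuous.prodMk_left ζ)

/-- The energy flux is `⟪u, P₁ u⟫` with `u = H w`. -/
theorem IsSmoothField.antitoneOn_energy (hw : IsSmoothField a b H P₀ R L w w')
    (hK : Coefficients a b γ m H H' P₁ P₀ R L) (hab : a ≤ b) :
    AntitoneOn (fun t => ∫ ζ in a..b, ⟪w t ζ, H ζ (w t ζ)⟫_ℝ) (Ici 0) := by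
  have hu := continuous_field_apply hK.H_cont hw.cont
  refine antitoneOn_integral_of_flux (e' := fun t ζ => 2 * ⟪w' t ζ, H ζ (w t ζ)⟫_ℝ)
    (f := fun t ζ => ⟪H ζ (w t ζ), P₁ (H ζ (w t ζ))⟫_ℝ) hab
    (continuous_density hK.H_cont hw.cont)
    (continuous_const.mul (hw.cont'.inner (𝕜 := ℝ) hu)) ?_ ?_ ?_ ?_
  · intro t
    have := hu.comp (Continuous.prodMk_right t)
    exact this.inner (𝕜 := ℝ) (P₁.continuous.comp this)
  · intro t ht ζ hζ
    have h := hw.deriv_time t ht ζ hζ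
    have h2 := h.inner ℝ ((H ζ).hasFDerivAt.comp_hasDerivAt t h)
    refine h2.congr_deriv ?_
    simp only [Function.comp_apply]
    rw [← hK.H_symm, real_inner_comm, two_mul]
  · intro t ht ζ hζ
    have h := hw.deriv_space t ht ζ hζ
    have h2 := h.inner ℝ (P₁.hasFDerivAt.comp_hasDerivAt ζ h)
    refine h2.congr_deriv ?_
    simp only [Function.comp_apply]
    rw [← hK.P₁_symm _ (H ζ (w t ζ)), hK.P₁_R, real_inner_comm, ← two_mul, inner_sub_left,
      hK.P₀_skew, sub_zero]
  · intro t ht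
    exact hK.dissipative _ _ (hw.bc t ht.le)

/-- `cone_estimate` applies with `q = ⟪w, H w⟫` and `p = ⟪w, R w⟫`: the terms with a time derivative
in `∂_ζ q` add up to `∂ₜ p`, because `R` is symmetric. -/
theorem IsSmoothField.sideways (hw : IsSmoothField a b H P₀ R L w w')
    (hK : Coefficients a b γ m H H' P₁ P₀ R L) {C : ℝ}
    (hC : ∀ ζ ∈ Icc a b, ∀ x,
      |2 * ⟪x, R (P₀ (H ζ x))⟫_ℝ + ⟪x, H' ζ x⟫_ℝ| ≤ C * ⟪x, H ζ x⟫_ℝ)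
    {ζ₁ ζ₂ s t : ℝ} (hζ₁ : ζ₁ ∈ Icc a b) (hζ₂ : ζ₂ ∈ Icc a b) (hst : s ≤ t)
    (hs : 0 ≤ s - γ * |ζ₂ - ζ₁|) :
    ∫ r in s..t, ⟪w r ζ₁, H ζ₁ (w r ζ₁)⟫_ℝ ≤ Real.exp (C * |ζ₂ - ζ₁|) *
      ∫ r in (s - γ * |ζ₂ - ζ₁|)..(t + γ * |ζ₂ - ζ₁|), ⟪w r ζ₂, H ζ₂ (w r ζ₂)⟫_ℝ := by
  have hu := continuous_field_apply hK.H_cont hw.cont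
  refine cone_estimate (q := fun t ζ => ⟪w t ζ, H ζ (w t ζ)⟫_ℝ)
    (q₁ := fun t ζ => 2 * ⟪w' t ζ, H ζ (w t ζ)⟫_ℝ)
    (q₂ := fun t ζ => 2 * ⟪w t ζ, R (w' t ζ - P₀ (H ζ (w t ζ)))⟫_ℝ - ⟪w t ζ, H' ζ (w t ζ)⟫_ℝ)
    (p := fun t ζ => ⟪w t ζ, R (w t ζ)⟫_ℝ) (p₁ := fun t ζ => 2 * ⟪w' t ζ, R (w t ζ)⟫_ℝ)
    hK.γ_pos (continuous_density hK.H_cont hw.cont)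
    (continuous_const.mul (hw.cont'.inner (𝕜 := ℝ) hu)) ?_
    ?_ ?_ ?_ ?_ ?_
    (fun t _ ζ _ => hK.cone ζ _) hζ₁ hζ₂ hst hs
  · refine (continuous_const.mul (hw.cont.inner (𝕜 := ℝ) (R.continuous.comp
      (hw.cont'.sub (P₀.continuous.comp hu))))).sub ?_
    exact continuous_density hK.H'_cont hw.cont
  · have hR : Continuous fun z : ℝ × ℝ => R (w z.1 z.2) := R.continuous.comp hw.cont
    exact continuous_const.mul (hw.cont'.inner (𝕜 := ℝ) hR)
  · intro t ht ζ hζ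
    have h := hw.deriv_time t ht ζ hζ
    have h2 := h.inner ℝ ((H ζ).hasFDerivAt.comp_hasDerivAt t h)
    refine h2.congr_deriv ?_
    simp only [Function.comp_apply]
    rw [← hK.H_symm, real_inner_comm, two_mul]
  · intro t ht ζ hζ
    exact hasDerivAt_inner_of_hasDerivAt_apply hK.H_symm
      (hw.cont.comp (Continuous.prodMk_right t)).continuousAt (hK.H_deriv ζ hζ)
      (hw.deriv_space t ht ζ hζ)
  · intro t ht ζ hζ
    have h := hw.deriv_time t ht ζ hζ
    have h2 := h.inner ℝ (R.hasFDerivAt.comp_hasDerivAt t h)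
    refine h2.congr_deriv ?_
    simp only [Function.comp_apply]
    rw [← hK.R_symm, real_inner_comm, two_mul]
  · intro t ht ζ hζ
    refine le_of_eq_of_le ?_ (hC ζ (Ioo_subset_Icc_self hζ) (w t ζ))
    rw [← abs_neg]
    congr 1
    rw [map_sub, inner_sub_right, ← hK.R_symm (w t ζ) (w' t ζ), real_inner_comm (w' t ζ)]
    ring

/-- The Steklov average `h⁻¹ ∫_t^{t+h} w(s,ζ) ds`, written so that it is jointly continuous in
`(h,t,ζ)` also at `h = 0`, where it is `w(t,ζ)`. -/
noncomputable def steklov (w : ℝ → ℝ → V) (h t ζ : ℝ) : V := ∫ θ in (0 : ℝ)..1, w (t + h * θ) ζ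

theorem steklov_zero [CompleteSpace V] (w : ℝ → ℝ → V) (t ζ : ℝ) : steklov w 0 t ζ = w t ζ := by
  simp [steklov]

theorem continuous_steklov (hw : Continuous (uncurry w)) :
    Continuous fun z : ℝ × ℝ × ℝ => steklov w z.1 z.2.1 z.2.2 := by
  refine intervalIntegral.continuous_parametric_intervalIntegral_of_continuous' ?_ _ _
  have : Continuous fun z : (ℝ × ℝ × ℝ) × ℝ => (z.1.2.1 + z.1.1 * z.2, z.1.2.2) := by fun_prop
  exact hw.comp this

theorem steklov_eq {h : ℝ} (hh : h ≠ 0) (t ζ : ℝ) :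
    steklov w h t ζ = h⁻¹ • ∫ s in t..(t + h), w s ζ := by
  rw [steklov, intervalIntegral.integral_comp_add_mul (fun s => w s ζ) hh]
  simp

/-- Time averages of a mild field solve the equation pointwise: the integrated equation between `t`
and `t + h` expresses `H` times the average as a primitive in space of a continuous function. -/
theorem IsMildField.smooth_steklov [CompleteSpace V] [CompleteSpace Z]
    (hw : IsMildField a b H P₁ P₀ L w)
    (hK : Coefficients a b γ m H H' P₁ P₀ R L) {h : ℝ} (hh : 0 < h) :
    IsSmoothField a b H P₀ R L (steklov w h) (fun t ζ => h⁻¹ • (w (t + h) ζ - w t ζ)) := by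
  have hcw : ∀ ζ, Continuous fun s => w s ζ := fun ζ => hw.cont.comp (Continuous.prodMk_left ζ)
  have hu := continuous_field_apply hK.H_cont hw.cont
  have hX : Continuous (uncurry (steklov w h)) :=
    (continuous_steklov hw.cont).comp (Continuous.prodMk_right h)
  have hY : Continuous (uncurry fun t ζ => h⁻¹ • (w (t + h) ζ - w t ζ)) := by
    have : Continuous fun z : ℝ × ℝ => (z.1 + h, z.2) := by fun_prop
    exact ((hw.cont.comp this).sub hw.cont).const_smul h⁻¹
  have hHX : ∀ t z, H z (steklov w h t z) = h⁻¹ • ∫ s in t..(t + h), H z (w s z) := by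
    intro t z
    rw [steklov_eq hh.ne', map_smul,
      ContinuousLinearMap.intervalIntegral_comp_comm _ ((hcw z).intervalIntegrable _ _)]
  have hHXc : ∀ t, Continuous fun z => H z (steklov w h t z) := fun t =>
    (continuous_field_apply hK.H_cont hX).comp (Continuous.prodMk_right t)
  refine ⟨hX, hY, ?_, ?_, ?_⟩
  · intro t _ ζ _
    have hI : ∀ t, HasDerivAt (fun t => ∫ s in (0 : ℝ)..t, w s ζ) (w t ζ) t := fun t =>
      (hcw ζ).integral_hasStrictDerivAt 0 t |>.hasDerivAt
    have h1 := (((hI (t + h)).comp_add_const t h).sub (hI t)).const_smul h⁻¹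
    refine h1.congr_of_eventuallyEq (Eventually.of_forall fun r => ?_)
    change steklov w h r ζ = h⁻¹ • ((∫ s in (0 : ℝ)..(r + h), w s ζ) - ∫ s in (0 : ℝ)..r, w s ζ)
    rw [steklov_eq hh.ne', intervalIntegral.integral_interval_sub_left
      ((hcw ζ).intervalIntegrable _ _) ((hcw ζ).intervalIntegrable _ _)]
  · intro t ht ζ hζ
    -- the integrated equation between the times `t` and `t + h`, solved for `H w`
    have hrep : ∀ z ∈ Icc a b, H z (steklov w h t z) = H a (steklov w h t a) +
        R ((∫ s in a..z, h⁻¹ • (w (t + h) s - w t s)) -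
          P₀ (∫ s in a..z, H s (steklov w h t s))) := by
      intro z hz
      have hev := hw.evol t (t + h) ht.le (by linarith) z hz
      have hc1 : ∀ z, Continuous fun r => H z (w r z) := fun z =>
        hu.comp (Continuous.prodMk_left z)
      have hc2 : Continuous fun r => ∫ s in a..z, H s (w r s) :=
        intervalIntegral.continuous_parametric_intervalIntegral_of_continuous'
          (f := fun r s => H s (w r s)) hu a z
      have hc3 : Continuous fun r => H z (w r z) - H a (w r a) := (hc1 z).sub (hc1 a)
      have hswap : ∫ r in t..(t + h), ∫ s in a..z, H s (w r s) =
          ∫ s in a..z, ∫ r in t..(t + h), H s (w r s) := by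
        refine intervalIntegral_intervalIntegral_swap ?_
        refine IntegrableOn.mono_set ?_
          (prod_mono uIoc_subset_uIcc uIoc_subset_uIcc)
        exact hu.continuousOn.integrableOn_compact (isCompact_uIcc.prod isCompact_uIcc)
      have hi1 : IntervalIntegrable (fun r => P₁ (H z (w r z) - H a (w r a))) volume t (t + h) :=
        (P₁.continuous.comp hc3).intervalIntegrable _ _
      have hi2 : IntervalIntegrable (fun r => P₀ (∫ s in a..z, H s (w r s))) volume t (t + h) :=
        (P₀.continuous.comp hc2).intervalIntegrable _ _
      rw [intervalIntegral.integral_add hi1 hi2,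
        ContinuousLinearMap.intervalIntegral_comp_comm P₁ (hc3.intervalIntegrable _ _),
        ContinuousLinearMap.intervalIntegral_comp_comm P₀ (hc2.intervalIntegrable _ _),
        intervalIntegral.integral_sub ((hc1 z).intervalIntegrable _ _)
          ((hc1 a).intervalIntegrable _ _), hswap] at hev
      have hR := congrArg R hev
      rw [map_add, hK.R_P₁] at hR
      simp only [hHX]
      rw [intervalIntegral.integral_smul, intervalIntegral.integral_smul, map_smul, ← smul_sub,
        map_smul, map_sub, hR, ← smul_add]
      congr 1
      abel
    have hd1 : HasDerivAt (fun z => ∫ s in a..z, h⁻¹ • (w (t + h) s - w t s))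
        (h⁻¹ • (w (t + h) ζ - w t ζ)) ζ :=
      ((hY.comp (Continuous.prodMk_right t)).integral_hasStrictDerivAt a ζ).hasDerivAt
    have hd2 : HasDerivAt (fun z => ∫ s in a..z, H s (steklov w h t s))
        (H ζ (steklov w h t ζ)) ζ := ((hHXc t).integral_hasStrictDerivAt a ζ).hasDerivAt
    have hd3 := (R.hasFDerivAt.comp_hasDerivAt ζ
      (hd1.sub (P₀.hasFDerivAt.comp_hasDerivAt ζ hd2))).const_add (H a (steklov w h t a))
    refine hd3.congr_of_eventuallyEq ?_
    filter_upwards [Icc_mem_nhds hζ.1 hζ.2] with z hz using hrep z hz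
  · intro t ht
    have hc1 : ∀ z, Continuous fun r => H z (w r z) := fun z =>
      hu.comp (Continuous.prodMk_left z)
    have hi : IntervalIntegrable (fun r => (H b (w r b), H a (w r a))) volume t (t + h) :=
      ((hc1 b).prodMk (hc1 a)).intervalIntegrable _ _
    have hpair : (∫ r in t..(t + h), H b (w r b), ∫ r in t..(t + h), H a (w r a)) =
        ∫ r in t..(t + h), (H b (w r b), H a (w r a)) := by
      refine Prod.ext ?_ ?_
      · exact (ContinuousLinearMap.intervalIntegral_comp_comm
          (ContinuousLinearMap.fst ℝ V V) hi)
      · exact (ContinuousLinearMap.intervalIntegral_comp_comm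
          (ContinuousLinearMap.snd ℝ V V) hi)
    rw [hHX, hHX, ← Prod.smul_mk, hpair, map_smul,
      ← ContinuousLinearMap.intervalIntegral_comp_comm L hi,
      intervalIntegral.integral_zero_ae (Eventually.of_forall fun r hr => ?_), smul_zero]
    rw [uIoc_of_le (by linarith)] at hr
    exact hw.bc r (ht.trans hr.1.le)

/-- Total energy and window integrals depend continuously on the averaging parameter. -/
theorem continuous_integral_steklov_density (hH : Continuous H) (hw : Continuous (uncurry w))
    {c d : ℝ → ℝ} (hc : Continuous c) (hd : Continuous d) (s t : ℝ) :
    Continuous fun h => ∫ r in s..t,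
      ⟪steklov w h (c r) (d r), H (d r) (steklov w h (c r) (d r))⟫_ℝ := by
  refine intervalIntegral.continuous_parametric_intervalIntegral_of_continuous' ?_ s t
  have h1 : Continuous fun z : ℝ × ℝ => steklov w z.1 (c z.2) (d z.2) := by
    have : Continuous fun z : ℝ × ℝ => (z.1, c z.2, d z.2) := by fun_prop
    exact (continuous_steklov hw).comp this
  have h2 : Continuous fun z : ℝ × ℝ => H (d z.2) := by fun_prop
  exact h1.inner (𝕜 := ℝ) (h2.clm_apply h1)

theorem le_of_forall_pos_le {f g : ℝ → ℝ} (hf : Continuous f) (hg : Continuous g)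
    (h : ∀ x > 0, f x ≤ g x) : f 0 ≤ g 0 :=
  ContinuousWithinAt.closure_le (s := Ioi 0) (by rw [closure_Ioi]; exact self_mem_Ici)
    hf.continuousWithinAt hg.continuousWithinAt h

theorem IsMildField.integral_energy_swap (hw : IsMildField a b H P₁ P₀ L w)
    (hH : Continuous H) (s t : ℝ) :
    ∫ ζ in a..b, ∫ r in s..t, ⟪w r ζ, H ζ (w r ζ)⟫_ℝ =
      ∫ r in s..t, ∫ ζ in a..b, ⟪w r ζ, H ζ (w r ζ)⟫_ℝ := by
  symm
  refine intervalIntegral_intervalIntegral_swap ?_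
  refine IntegrableOn.mono_set ?_ (prod_mono uIoc_subset_uIcc uIoc_subset_uIcc)
  exact (continuous_density hH hw.cont).continuousOn.integrableOn_compact
    (isCompact_uIcc.prod isCompact_uIcc)

variable [CompleteSpace V] [CompleteSpace Z]

theorem IsMildField.antitoneOn_energy (hw : IsMildField a b H P₁ P₀ L w)
    (hK : Coefficients a b γ m H H' P₁ P₀ R L) (hab : a ≤ b) :
    AntitoneOn (fun t => ∫ ζ in a..b, ⟪w t ζ, H ζ (w t ζ)⟫_ℝ) (Ici 0) := by
  intro s hs t ht hst
  have := le_of_forall_pos_le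
    (continuous_integral_steklov_density hK.H_cont hw.cont continuous_const continuous_id a b)
    (continuous_integral_steklov_density hK.H_cont hw.cont continuous_const continuous_id a b)
    fun h hh => (hw.smooth_steklov hK hh).antitoneOn_energy hK hab hs ht hst
  simpa [steklov_zero] using this

theorem IsMildField.sideways (hw : IsMildField a b H P₁ P₀ L w)
    (hK : Coefficients a b γ m H H' P₁ P₀ R L) {C : ℝ}
    (hC : ∀ ζ ∈ Icc a b, ∀ x,
      |2 * ⟪x, R (P₀ (H ζ x))⟫_ℝ + ⟪x, H' ζ x⟫_ℝ| ≤ C * ⟪x, H ζ x⟫_ℝ)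
    {ζ₁ ζ₂ s t : ℝ} (hζ₁ : ζ₁ ∈ Icc a b) (hζ₂ : ζ₂ ∈ Icc a b) (hst : s ≤ t)
    (hs : 0 ≤ s - γ * |ζ₂ - ζ₁|) :
    ∫ r in s..t, ⟪w r ζ₁, H ζ₁ (w r ζ₁)⟫_ℝ ≤ Real.exp (C * |ζ₂ - ζ₁|) *
      ∫ r in (s - γ * |ζ₂ - ζ₁|)..(t + γ * |ζ₂ - ζ₁|), ⟪w r ζ₂, H ζ₂ (w r ζ₂)⟫_ℝ := by
  have := le_of_forall_pos_le
    (continuous_integral_steklov_density hK.H_cont hw.cont continuous_id continuous_const s t)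
    (continuous_const.mul (continuous_integral_steklov_density hK.H_cont hw.cont continuous_id
      continuous_const (s - γ * |ζ₂ - ζ₁|) (t + γ * |ζ₂ - ζ₁|)))
    fun h hh => (hw.smooth_steklov hK hh).sideways hK hC hζ₁ hζ₂ hst hs
  simpa [steklov_zero] using this

/-- The sideways estimate with the windows and the constant made independent of the two points. -/
theorem IsMildField.sideways_uniform (hw : IsMildField a b H P₁ P₀ L w)
    (hK : Coefficients a b γ m H H' P₁ P₀ R L) {C : ℝ} (hC0 : 0 ≤ C)
    (hC : ∀ ζ ∈ Icc a b, ∀ x,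
      |2 * ⟪x, R (P₀ (H ζ x))⟫_ℝ + ⟪x, H' ζ x⟫_ℝ| ≤ C * ⟪x, H ζ x⟫_ℝ)
    {ζ₁ ζ₂ s t : ℝ} (hζ₁ : ζ₁ ∈ Icc a b) (hζ₂ : ζ₂ ∈ Icc a b) (hst : s ≤ t)
    (hs : γ * (b - a) ≤ s) :
    ∫ r in s..t, ⟪w r ζ₁, H ζ₁ (w r ζ₁)⟫_ℝ ≤ Real.exp (C * (b - a)) *
      ∫ r in (s - γ * (b - a))..(t + γ * (b - a)), ⟪w r ζ₂, H ζ₂ (w r ζ₂)⟫_ℝ := by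
  have hd : |ζ₂ - ζ₁| ≤ b - a := by
    rw [abs_le]
    constructor <;> linarith [hζ₁.1, hζ₁.2, hζ₂.1, hζ₂.2]
  have hγd := mul_le_mul_of_nonneg_left hd hK.γ_pos.le
  have hγ0 : 0 ≤ γ * |ζ₂ - ζ₁| := mul_nonneg hK.γ_pos.le (abs_nonneg _)
  refine (hw.sideways hK hC hζ₁ hζ₂ hst (by linarith)).trans ?_
  have hcont := continuous_density_time hK.H_cont hw.cont ζ₂
  refine mul_le_mul (Real.exp_le_exp.2 (mul_le_mul_of_nonneg_left hd hC0)) ?_ ?_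
    (Real.exp_pos _).le
  · exact intervalIntegral.integral_mono_interval (by linarith) (by linarith) (by linarith)
      (Eventually.of_forall fun r => hK.nonneg ζ₂ _) (hcont.intervalIntegrable _ _)
  · exact intervalIntegral.integral_nonneg (by linarith) fun r _ => hK.nonneg ζ₂ _

/-- Observability: averaging the sideways estimate over all starting points bounds the energy by
the observation at `δ`, since the energy decreases. -/
theorem IsMildField.energy_le_observation (hw : IsMildField a b H P₁ P₀ L w)
    (hK : Coefficients a b γ m H H' P₁ P₀ R L) (hab : a ≤ b) {C : ℝ} (hC0 : 0 ≤ C)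
    (hC : ∀ ζ ∈ Icc a b, ∀ x,
      |2 * ⟪x, R (P₀ (H ζ x))⟫_ℝ + ⟪x, H' ζ x⟫_ℝ| ≤ C * ⟪x, H ζ x⟫_ℝ)
    {δ s t : ℝ} (hδ : δ ∈ Icc a b) (hst : s ≤ t) (hs : γ * (b - a) ≤ s) :
    (t - s) * ∫ ζ in a..b, ⟪w (t + γ * (b - a)) ζ, H ζ (w (t + γ * (b - a)) ζ)⟫_ℝ ≤
      (b - a) * (Real.exp (C * (b - a)) *
        ∫ r in (s - γ * (b - a))..(t + γ * (b - a)), ⟪w r δ, H δ (w r δ)⟫_ℝ) := by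
  have hq := continuous_density hK.H_cont hw.cont
  have hγ0 : 0 ≤ γ * (b - a) := mul_nonneg hK.γ_pos.le (by linarith)
  have h1 : ∫ ζ in a..b, ∫ r in s..t, ⟪w r ζ, H ζ (w r ζ)⟫_ℝ ≤
      ∫ _ζ in a..b, Real.exp (C * (b - a)) *
        ∫ r in (s - γ * (b - a))..(t + γ * (b - a)), ⟪w r δ, H δ (w r δ)⟫_ℝ := by
    refine intervalIntegral.integral_mono_on hab ?_ intervalIntegrable_const ?_
    · refine Continuous.intervalIntegrable ?_ _ _
      exact intervalIntegral.continuous_parametric_intervalIntegral_of_continuous'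
        (f := fun ζ r => ⟪w r ζ, H ζ (w r ζ)⟫_ℝ) (hq.comp continuous_swap) s t
    · exact fun ζ hζ => hw.sideways_uniform hK hC0 hC hζ hδ hst hs
  rw [hw.integral_energy_swap hK.H_cont, intervalIntegral.integral_const, smul_eq_mul] at h1
  refine le_trans ?_ h1
  rw [← smul_eq_mul, ← intervalIntegral.integral_const]
  refine intervalIntegral.integral_mono_on hst intervalIntegrable_const ?_ ?_
  · exact (intervalIntegral.continuous_parametric_intervalIntegral_of_continuous' hq a
      b).intervalIntegrable _ _
  · intro r hr
    exact hw.antitoneOn_energy hK hab (show (0 : ℝ) ≤ r by linarith [hr.1])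
      (show (0 : ℝ) ≤ t + γ * (b - a) by linarith) (by linarith [hr.2])

/-- Admissibility: averaging the sideways estimate over all end points bounds the observation at
`δ` by the energy, since the energy decreases. -/
theorem IsMildField.observation_le_energy (hw : IsMildField a b H P₁ P₀ L w)
    (hK : Coefficients a b γ m H H' P₁ P₀ R L) (hab : a ≤ b) {C : ℝ} (hC0 : 0 ≤ C)
    (hC : ∀ ζ ∈ Icc a b, ∀ x,
      |2 * ⟪x, R (P₀ (H ζ x))⟫_ℝ + ⟪x, H' ζ x⟫_ℝ| ≤ C * ⟪x, H ζ x⟫_ℝ)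
    {δ s t : ℝ} (hδ : δ ∈ Icc a b) (hst : s ≤ t) (hs : γ * (b - a) ≤ s) :
    (b - a) * ∫ r in s..t, ⟪w r δ, H δ (w r δ)⟫_ℝ ≤
      Real.exp (C * (b - a)) * ((t + γ * (b - a) - (s - γ * (b - a))) *
        ∫ ζ in a..b, ⟪w (s - γ * (b - a)) ζ, H ζ (w (s - γ * (b - a)) ζ)⟫_ℝ) := by
  have hq := continuous_density hK.H_cont hw.cont
  have hγ0 : 0 ≤ γ * (b - a) := mul_nonneg hK.γ_pos.le (by linarith)
  have h1 : ∫ _ζ in a..b, ∫ r in s..t, ⟪w r δ, H δ (w r δ)⟫_ℝ ≤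
      ∫ ζ in a..b, Real.exp (C * (b - a)) *
        ∫ r in (s - γ * (b - a))..(t + γ * (b - a)), ⟪w r ζ, H ζ (w r ζ)⟫_ℝ := by
    refine intervalIntegral.integral_mono_on hab intervalIntegrable_const ?_ ?_
    · refine Continuous.intervalIntegrable (continuous_const.mul ?_) _ _
      exact intervalIntegral.continuous_parametric_intervalIntegral_of_continuous'
        (f := fun ζ r => ⟪w r ζ, H ζ (w r ζ)⟫_ℝ) (hq.comp continuous_swap) _ _
    · exact fun ζ hζ => hw.sideways_uniform hK hC0 hC hδ hζ hst hs
  rw [intervalIntegral.integral_const_mul, hw.integral_energy_swap hK.H_cont,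
    intervalIntegral.integral_const, smul_eq_mul] at h1
  refine h1.trans (mul_le_mul_of_nonneg_left ?_ (Real.exp_pos _).le)
  refine le_of_le_of_eq ?_ ((intervalIntegral.integral_const _).trans (smul_eq_mul _ _))
  refine intervalIntegral.integral_mono_on (by linarith) ?_ intervalIntegrable_const ?_
  · exact (intervalIntegral.continuous_parametric_intervalIntegral_of_continuous' hq a
      b).intervalIntegrable _ _
  · intro r hr
    exact hw.antitoneOn_energy hK hab (show (0 : ℝ) ≤ s - γ * (b - a) by linarith)
      (show (0 : ℝ) ≤ r by linarith [hr.1]) hr.1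

end Fields

/-! ### Real matrices acting on `𝕂ⁿ` and the boundary condition -/

section Matrices

variable {𝕂 : Type*} [RCLike 𝕂] {n : ℕ}

theorem act_apply (M : Matrix (Fin n) (Fin n) ℝ) (x : Vec 𝕂 n) (i : Fin n) :
    act 𝕂 M x i = ∑ j, M i j • x j := by
  simp [act, Matrix.toLpLin_apply, Matrix.mulVec, dotProduct, RCLike.real_smul_eq_coe_mul]

theorem act_add (M N : Matrix (Fin n) (Fin n) ℝ) (x : Vec 𝕂 n) :
    act 𝕂 (M + N) x = act 𝕂 M x + act 𝕂 N x := by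
  ext i
  simp [act_apply, add_smul, Finset.sum_add_distrib]

theorem act_sub (M N : Matrix (Fin n) (Fin n) ℝ) (x : Vec 𝕂 n) :
    act 𝕂 (M - N) x = act 𝕂 M x - act 𝕂 N x := by
  ext i
  simp [act_apply, sub_smul, Finset.sum_sub_distrib]

theorem act_neg (M : Matrix (Fin n) (Fin n) ℝ) (x : Vec 𝕂 n) : act 𝕂 (-M) x = -act 𝕂 M x := by
  ext i
  simp [act_apply]

theorem act_smul (c : ℝ) (M : Matrix (Fin n) (Fin n) ℝ) (x : Vec 𝕂 n) :
    act 𝕂 (c • M) x = c • act 𝕂 M x := by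
  ext i
  simp [act_apply, Finset.smul_sum, smul_smul]

theorem act_one (x : Vec 𝕂 n) : act 𝕂 (1 : Matrix (Fin n) (Fin n) ℝ) x = x := by
  ext i
  simp [act_apply, Matrix.one_apply]

theorem act_mul (M N : Matrix (Fin n) (Fin n) ℝ) (x : Vec 𝕂 n) :
    act 𝕂 (M * N) x = act 𝕂 M (act 𝕂 N x) := by
  ext i
  simp only [act_apply, Matrix.mul_apply, Finset.sum_smul, Finset.smul_sum, smul_smul]
  rw [Finset.sum_comm]

theorem re_inner_eq (x y : Vec 𝕂 n) : RCLike.re (inner 𝕂 x y) = ⟪x, y⟫_ℝ := by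
  simp only [PiLp.inner_apply, map_sum]
  rfl

theorem quadForm_eq (M : Matrix (Fin n) (Fin n) ℝ) (x : Vec 𝕂 n) :
    quadForm 𝕂 M x = ⟪x, act 𝕂 M x⟫_ℝ :=
  re_inner_eq _ _

theorem inner_act (M : Matrix (Fin n) (Fin n) ℝ) (x y : Vec 𝕂 n) :
    ⟪x, act 𝕂 M y⟫_ℝ = ∑ i, ∑ j, M i j * ⟪x i, y j⟫_ℝ := by
  simp only [PiLp.inner_apply, act_apply, inner_sum, real_inner_smul_right]

theorem act_inner (M : Matrix (Fin n) (Fin n) ℝ) (x y : Vec 𝕂 n) :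
    ⟪act 𝕂 M x, y⟫_ℝ = ⟪x, act 𝕂 M.transpose y⟫_ℝ := by
  rw [real_inner_comm, inner_act, inner_act, Finset.sum_comm]
  simp only [Matrix.transpose_apply, real_inner_comm]

theorem inner_act_nonneg {M : Matrix (Fin n) (Fin n) ℝ} (hM : M.PosSemidef) (x : Vec 𝕂 n) :
    0 ≤ ⟪x, act 𝕂 M x⟫_ℝ := by
  have h1 := hM.dotProduct_mulVec_nonneg (fun i => RCLike.re (x i))
  have h2 := hM.dotProduct_mulVec_nonneg (fun i => RCLike.im (x i))
  rw [inner_act]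
  refine (add_nonneg h1 h2).trans_eq ?_
  simp only [dotProduct, Matrix.mulVec, Finset.mul_sum, ← Finset.sum_add_distrib]
  refine Finset.sum_congr rfl fun i _ => Finset.sum_congr rfl fun j _ => ?_
  have : ⟪x i, x j⟫_ℝ = RCLike.re (x i) * RCLike.re (x j) + RCLike.im (x i) * RCLike.im (x j) := by
    change RCLike.re (inner 𝕂 (x i) (x j)) = _
    simp [RCLike.inner_apply]
    ring
  rw [this]
  simp
  ring

variable (𝕂) in
/-- `act` as a continuous real-linear map. -/
noncomputable def actL (M : Matrix (Fin n) (Fin n) ℝ) : Vec 𝕂 n →L[ℝ] Vec 𝕂 n :=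
  LinearMap.toContinuousLinearMap ((act 𝕂 M).restrictScalars ℝ)

@[simp]
theorem actL_apply (M : Matrix (Fin n) (Fin n) ℝ) (x : Vec 𝕂 n) : actL 𝕂 M x = act 𝕂 M x := rfl

variable (𝕂) in
/-- `actL` as a linear map in the matrix. -/
noncomputable def actLin : Matrix (Fin n) (Fin n) ℝ →ₗ[ℝ] (Vec 𝕂 n →L[ℝ] Vec 𝕂 n) where
  toFun := actL 𝕂
  map_add' M N := ContinuousLinearMap.ext fun x => act_add M N x
  map_smul' c M := ContinuousLinearMap.ext fun x => act_smul c M x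

theorem actL_eq_sum (M : Matrix (Fin n) (Fin n) ℝ) :
    actL 𝕂 M = ∑ i, ∑ j, M i j • actL 𝕂 (Matrix.single i j 1) := by
  change actLin 𝕂 M = _
  conv_lhs => rw [Matrix.matrix_eq_sum_single M]
  simp only [map_sum]
  refine Finset.sum_congr rfl fun i _ => Finset.sum_congr rfl fun j _ => ?_
  rw [← mul_one (M i j), ← smul_eq_mul, ← Matrix.smul_single, map_smul]
  simp [actLin]

theorem continuous_actL {X : Type*} [TopologicalSpace X] {M : X → Matrix (Fin n) (Fin n) ℝ}
    (hM : ∀ i j, Continuous fun x => M x i j) : Continuous fun x => actL 𝕂 (M x) := by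
  simp only [actL_eq_sum (M _)]
  exact continuous_finsetSum _ fun i _ => continuous_finsetSum _ fun j _ =>
    (hM i j).smul continuous_const

theorem hasDerivAt_actL {M : ℝ → Matrix (Fin n) (Fin n) ℝ} {M' : Matrix (Fin n) (Fin n) ℝ} {t : ℝ}
    (hM : ∀ i j, HasDerivAt (fun x => M x i j) (M' i j) t) :
    HasDerivAt (fun x => actL 𝕂 (M x)) (actL 𝕂 M') t := by
  rw [actL_eq_sum M']
  simp only [actL_eq_sum (M _)]
  exact HasDerivAt.fun_sum fun i _ => HasDerivAt.fun_sum fun j _ => (hM i j).smul_const (actL 𝕂 (Matrix.single i j 1))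

theorem norm_act_transpose_sq (M : Matrix (Fin n) (Fin n) ℝ) (x : Vec 𝕂 n) :
    ‖act 𝕂 M.transpose x‖ ^ 2 = ⟪x, act 𝕂 (M * M.transpose) x⟫_ℝ := by
  rw [← real_inner_self_eq_norm_sq, act_inner, Matrix.transpose_transpose, act_mul]

/-- The identity `(A + B)(A + B)ᵀ - (A - B)(A - B)ᵀ = 2 (A Bᵀ + B Aᵀ)`, read as a comparison. -/
theorem norm_act_sub_transpose_le {A B : Matrix (Fin n) (Fin n) ℝ}
    (h : (A * B.transpose + B * A.transpose).PosSemidef) (x : Vec 𝕂 n) :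
    ‖act 𝕂 (A - B).transpose x‖ ≤ ‖act 𝕂 (A + B).transpose x‖ := by
  refine le_of_sq_le_sq ?_ (norm_nonneg _)
  rw [norm_act_transpose_sq, norm_act_transpose_sq, ← sub_nonneg, ← inner_sub_right, ← act_sub]
  have : (A + B) * (A + B).transpose - (A - B) * (A - B).transpose =
      (2 : ℝ) • (A * B.transpose + B * A.transpose) := by
    rw [Matrix.transpose_add, Matrix.transpose_sub, two_smul]
    noncomm_ring
  rw [this, act_smul, inner_smul_right]
  exact mul_nonneg zero_le_two (inner_act_nonneg h x)

/-- A vector in the kernel of `(A + B)ᵀ` is also in the kernel of `(A - B)ᵀ`, by the comparison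
above, hence in the kernels of both `Aᵀ` and `Bᵀ`. -/
theorem isUnit_add_of_posSemidef {A B : Matrix (Fin n) (Fin n) ℝ}
    (h : (A * B.transpose + B * A.transpose).PosSemidef)
    (hinj : ∀ x : Vec ℝ n, act ℝ A.transpose x = 0 → act ℝ B.transpose x = 0 → x = 0) :
    IsUnit (A + B).transpose := by
  rw [← Matrix.mulVec_injective_iff_isUnit]
  rw [← Matrix.coe_mulVecLin, injective_iff_map_eq_zero]
  intro v hv
  have h1 : act ℝ (A + B).transpose (WithLp.toLp 2 v) = 0 := by
    ext i
    rw [act_apply]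
    exact congrFun hv i
  have h2 : act ℝ (A - B).transpose (WithLp.toLp 2 v) = 0 := by
    have := norm_act_sub_transpose_le h (WithLp.toLp 2 v : Vec ℝ n)
    rw [h1, norm_zero] at this
    exact norm_le_zero_iff.1 this
  rw [Matrix.transpose_add, act_add] at h1
  rw [Matrix.transpose_sub, act_sub, sub_eq_zero] at h2
  rw [h2, ← two_smul ℝ, smul_eq_zero] at h1
  have hB := h1.resolve_left two_ne_zero
  have := hinj _ (h2.trans hB) hB
  simpa using congrArg WithLp.ofLp this

/-- Dissipativity of the boundary condition `A e + B f = 0`: it reads `(A + B) p = -(A - B) q` with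
`p = e + f` and `q = e - f`, and `A Bᵀ + B Aᵀ ≥ 0` makes `(A + B)⁻¹ (A - B)` a contraction. -/
theorem inner_nonpos_of_boundary {A B : Matrix (Fin n) (Fin n) ℝ}
    (h : (A * B.transpose + B * A.transpose).PosSemidef) (hu : IsUnit (A + B).transpose)
    {e f : Vec 𝕂 n} (hef : act 𝕂 A e + act 𝕂 B f = 0) : ⟪e, f⟫_ℝ ≤ 0 := by
  obtain ⟨w, hSw⟩ : ∃ w, act 𝕂 (A + B).transpose w = e + f :=
    ⟨act 𝕂 ((A + B).transpose)⁻¹ (e + f), by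
      rw [← act_mul, Matrix.mul_nonsing_inv _ ((Matrix.isUnit_iff_isUnit_det _).1 hu), act_one]⟩
  have hpq : act 𝕂 (A + B) (e + f) = -act 𝕂 (A - B) (e - f) := by
    rw [eq_neg_iff_add_eq_zero]
    have : act 𝕂 (A + B) (e + f) + act 𝕂 (A - B) (e - f) =
        (2 : ℝ) • (act 𝕂 A e + act 𝕂 B f) := by
      simp only [act_add, act_sub, map_add, map_sub, two_smul]
      abel
    rw [this, hef, smul_zero]
  have h1 : ‖e + f‖ * ‖e + f‖ ≤ ‖e + f‖ * ‖e - f‖ := by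
    calc ‖e + f‖ * ‖e + f‖ = ⟪act 𝕂 (A + B).transpose w, e + f⟫_ℝ := by
          rw [hSw, real_inner_self_eq_norm_mul_norm]
      _ = -⟪act 𝕂 (A - B).transpose w, e - f⟫_ℝ := by
          rw [act_inner, act_inner, Matrix.transpose_transpose, Matrix.transpose_transpose, hpq,
            inner_neg_right]
      _ ≤ ‖act 𝕂 (A - B).transpose w‖ * ‖e - f‖ := by
          have := neg_le_of_abs_le (abs_real_inner_le_norm (act 𝕂 (A - B).transpose w) (e - f))
          linarith
      _ ≤ ‖e + f‖ * ‖e - f‖ := by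
          have := norm_act_sub_transpose_le h w
          rw [hSw] at this
          gcongr
  have h2 : ‖e + f‖ ≤ ‖e - f‖ := by
    rcases (norm_nonneg (e + f)).eq_or_lt with h0 | h0
    · rw [← h0]; exact norm_nonneg _
    · exact le_of_mul_le_mul_left h1 h0
  have h3 := norm_add_sq_real e f
  have h4 := norm_sub_sq_real e f
  have h5 := mul_self_le_mul_self (norm_nonneg _) h2
  nlinarith

/-- The block of `W_B` acting on the boundary effort. -/
def System.W₁ (Q : System n) : Matrix (Fin n) (Fin n) ℝ := fun i j => Q.W_B i (Sum.inl j)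

/-- The block of `W_B` acting on the boundary flow. -/
def System.W₂ (Q : System n) : Matrix (Fin n) (Fin n) ℝ := fun i j => Q.W_B i (Sum.inr j)

theorem effort_eq (ub ua : Vec 𝕂 n) : effort ub ua = (1 / Real.sqrt 2 : ℝ) • (ub + ua) :=
  algebraMap_smul 𝕂 (1 / Real.sqrt 2 : ℝ) (ub + ua)

theorem System.flow_eq (Q : System n) (ub ua : Vec 𝕂 n) :
    Q.flow ub ua = (1 / Real.sqrt 2 : ℝ) • (act 𝕂 Q.P₁ ub - act 𝕂 Q.P₁ ua) :=
  algebraMap_smul 𝕂 (1 / Real.sqrt 2 : ℝ) (act 𝕂 Q.P₁ ub - act 𝕂 Q.P₁ ua)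

theorem System.boundaryCondition_iff (Q : System n) (ub ua : Vec 𝕂 n) :
    Q.BoundaryCondition ub ua ↔ act 𝕂 Q.W₁ (effort ub ua) + act 𝕂 Q.W₂ (Q.flow ub ua) = 0 := by
  unfold System.BoundaryCondition
  rw [← WithLp.ofLp_eq_zero 2, funext_iff, funext_iff]
  refine forall_congr' fun i => ?_
  simp [Matrix.mulVec, dotProduct, act_apply, System.W₁, System.W₂, RCLike.real_smul_eq_coe_mul]

theorem System.Admissible.posSemidef_W {Q : System n} {a b : ℝ} (hQ : Q.Admissible a b) :
    (Q.W₁ * Q.W₂.transpose + Q.W₂ * Q.W₁.transpose).PosSemidef := by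
  have h := hQ.W_B_nonneg
  convert h using 1
  ext i j
  simp [Matrix.mul_apply, Fintype.sum_sum_type, Matrix.fromBlocks, System.W₁, System.W₂,
    Matrix.one_apply, add_comm]

theorem System.Admissible.isUnit_W {Q : System n} {a b : ℝ} (hQ : Q.Admissible a b) :
    IsUnit (Q.W₁ + Q.W₂).transpose := by
  refine isUnit_add_of_posSemidef hQ.posSemidef_W fun x h1 h2 => ?_
  have hli : LinearIndependent ℝ Q.W_B.row := by
    rw [linearIndependent_iff_card_eq_finrank_span, Fintype.card_fin, Set.finrank,
      ← Matrix.rank_eq_finrank_span_row, hQ.rank_W_B]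
  have hinj := Matrix.vecMul_injective_iff.2 hli
  have : Matrix.vecMul x.ofLp Q.W_B = Matrix.vecMul 0 Q.W_B := by
    rw [Matrix.zero_vecMul]
    ext k
    rcases k with k | k
    · have := congrArg (fun y : Vec ℝ n => y k) h1
      simpa [act_apply, System.W₁, Matrix.vecMul, dotProduct, mul_comm] using this
    · have := congrArg (fun y : Vec ℝ n => y k) h2
      simpa [act_apply, System.W₂, Matrix.vecMul, dotProduct, mul_comm] using this
  exact (WithLp.ofLp_eq_zero 2).1 (hinj this)

variable (𝕂) in
/-- The map `(u(b), u(a)) ↦ W_B (e_∂; f_∂)`. -/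
noncomputable def System.boundaryMap (Q : System n) : Vec 𝕂 n × Vec 𝕂 n →L[ℝ] Vec 𝕂 n :=
  (1 / Real.sqrt 2 : ℝ) •
    (actL 𝕂 Q.W₁ ∘L (ContinuousLinearMap.fst ℝ _ _ + ContinuousLinearMap.snd ℝ _ _) +
      actL 𝕂 Q.W₂ ∘L (actL 𝕂 Q.P₁ ∘L ContinuousLinearMap.fst ℝ _ _ -
        actL 𝕂 Q.P₁ ∘L ContinuousLinearMap.snd ℝ _ _))

theorem System.boundaryMap_eq_zero_iff (Q : System n) (ub ua : Vec 𝕂 n) :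
    Q.boundaryMap 𝕂 (ub, ua) = 0 ↔ Q.BoundaryCondition ub ua := by
  rw [Q.boundaryCondition_iff]
  rw [effort_eq, flow_eq, LinearMap.map_smul_of_tower, LinearMap.map_smul_of_tower, ← smul_add]
  simp [boundaryMap]

theorem System.Admissible.dissipative {Q : System n} {a b : ℝ} (hQ : Q.Admissible a b)
    {ub ua : Vec 𝕂 n} (h : Q.BoundaryCondition ub ua) :
    ⟪ub, act 𝕂 Q.P₁ ub⟫_ℝ ≤ ⟪ua, act 𝕂 Q.P₁ ua⟫_ℝ := by
  rw [Q.boundaryCondition_iff] at h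
  have h0 := inner_nonpos_of_boundary hQ.posSemidef_W hQ.isUnit_W h
  rw [effort_eq, Q.flow_eq, real_inner_smul_left, real_inner_smul_right] at h0
  have hpos : 0 < 1 / Real.sqrt 2 := by positivity
  have h1 : ⟪ub + ua, act 𝕂 Q.P₁ ub - act 𝕂 Q.P₁ ua⟫_ℝ ≤ 0 := by
    by_contra! hcon
    exact absurd h0 (not_le.2 (mul_pos hpos (mul_pos hpos hcon)))
  have hs : ⟪ua, act 𝕂 Q.P₁ ub⟫_ℝ = ⟪ub, act 𝕂 Q.P₁ ua⟫_ℝ := by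
    rw [real_inner_comm, act_inner, hQ.P₁_symm.eq]
  rw [inner_add_left, inner_sub_right, inner_sub_right, hs] at h1
  linarith

end Matrices

/-! ### Coefficients extended to the real line -/

section Extension

variable {𝕂 : Type*} [RCLike 𝕂] {n : ℕ} {a b : ℝ}

variable (𝕂) in
/-- Multiplication by `H`, extended from `[a,b]` to `ℝ` by its values at the end points. -/
noncomputable def System.Hext (Q : System n) (hab : a ≤ b) (ζ : ℝ) : Vec 𝕂 n →L[ℝ] Vec 𝕂 n :=
  actL 𝕂 (Q.H (projIcc a b hab ζ))

variable (𝕂) in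
/-- Multiplication by the derivative of `H`, extended from `[a,b]` to `ℝ` by its values at the end
points. -/
noncomputable def System.H'ext (Q : System n) (hab : a ≤ b) (ζ : ℝ) : Vec 𝕂 n →L[ℝ] Vec 𝕂 n :=
  actL 𝕂 (fun i j => derivWithin (fun z => Q.H z i j) (Icc a b) (projIcc a b hab ζ))

theorem continuous_comp_projIcc {X : Type*} [TopologicalSpace X] {f : ℝ → X} (hab : a ≤ b)
    (hf : ContinuousOn f (Icc a b)) : Continuous fun ζ => f (projIcc a b hab ζ) :=
  hf.comp_continuous (continuous_subtype_val.comp continuous_projIcc) fun ζ =>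
    (projIcc a b hab ζ).2

theorem coe_projIcc_of_mem (hab : a ≤ b) {ζ : ℝ} (hζ : ζ ∈ Icc a b) :
    (projIcc a b hab ζ : ℝ) = ζ := by
  rw [projIcc_of_mem hab hζ]

theorem System.Hext_apply (Q : System n) (hab : a ≤ b) {ζ : ℝ} (hζ : ζ ∈ Icc a b) (x : Vec 𝕂 n) :
    Q.Hext 𝕂 hab ζ x = act 𝕂 (Q.H ζ) x := by
  rw [Hext, coe_projIcc_of_mem hab hζ, actL_apply]

theorem System.Admissible.isUnit_det_H {Q : System n} (hQ : Q.Admissible a b) {ζ : ℝ}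
    (hζ : ζ ∈ Icc a b) : IsUnit (Q.H ζ).det := by
  obtain ⟨m, M, hm, -, hb⟩ := hQ.H_bounds
  have h : (Q.H ζ).PosDef := by
    have h2 := ((Matrix.PosDef.one (n := Fin n) (R := ℝ)).smul hm).add_posSemidef (hb ζ hζ).1
    rwa [add_sub_cancel] at h2
  exact (Matrix.isUnit_iff_isUnit_det _).1 h.isUnit

theorem System.Admissible.continuousOn_H_inv {Q : System n} (hQ : Q.Admissible a b) :
    ContinuousOn (fun ζ => (Q.H ζ)⁻¹) (Icc a b) := by
  have hH : ContinuousOn Q.H (Icc a b) := continuousOn_pi.2 fun i =>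
    continuousOn_pi.2 fun j => (hQ.H_contDiff i j).continuousOn
  intro ζ hζ
  refine (continuousAt_matrix_inv _ ?_).comp_continuousWithinAt (hH ζ hζ)
  have := (hQ.isUnit_det_H hζ).ne_zero
  simpa using continuousAt_inv₀ this

theorem System.Admissible.coefficients {Q : System n} (hQ : Q.Admissible a b) (hab : a ≤ b)
    {γ : ℝ} (hγ : 0 < γ) (hγH : ∀ ζ ∈ Icc a b,
      (γ • Q.H ζ - Q.P₁⁻¹).PosSemidef ∧ (γ • Q.H ζ + Q.P₁⁻¹).PosSemidef) :
    ∃ m, Coefficients a b γ m (Q.Hext 𝕂 hab) (Q.H'ext 𝕂 hab) (actL 𝕂 Q.P₁) (actL 𝕂 Q.P₀)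
      (actL 𝕂 Q.P₁⁻¹) (Q.boundaryMap 𝕂) := by
  obtain ⟨m, M, hm, -, hb⟩ := hQ.H_bounds
  have hdet := (Matrix.isUnit_iff_isUnit_det _).1 hQ.P₁_invertible
  refine ⟨m, ?_, ?_, ?_, ?_, hm, ?_, ?_, ?_, ?_, ?_, ?_, hγ, ?_, ?_⟩
  · exact continuous_actL fun i j =>
      continuous_comp_projIcc hab (hQ.H_contDiff i j).continuousOn
  · -- for `a = b` there is no unique derivative on `[a,b]`, but the extension is constant
    refine continuous_actL fun i j => ?_
    rcases hab.eq_or_lt with rfl | hlt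
    · have : ∀ ζ : ℝ, (projIcc a a hab ζ : ℝ) = a := fun ζ => by simpa using (projIcc a a hab ζ).2
      simp only [this]
      exact continuous_const
    · exact continuous_comp_projIcc hab
        ((hQ.H_contDiff i j).continuousOn_derivWithin (uniqueDiffOn_Icc hlt) le_rfl)
  · intro ζ hζ
    refine hasDerivAt_actL fun i j => ?_
    have hn : Icc a b ∈ 𝓝 ζ := Icc_mem_nhds hζ.1 hζ.2
    have hd := ((hQ.H_contDiff i j).differentiableOn one_ne_zero ζ
      (Ioo_subset_Icc_self hζ)).hasDerivWithinAt.hasDerivAt hn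
    rw [coe_projIcc_of_mem hab (Ioo_subset_Icc_self hζ)]
    refine hd.congr_of_eventuallyEq ?_
    filter_upwards [hn] with z hz
    rw [coe_projIcc_of_mem hab hz]
  · intro ζ x y
    change ⟪act 𝕂 _ x, y⟫_ℝ = ⟪x, act 𝕂 _ y⟫_ℝ
    rw [act_inner, (hQ.H_symm _ (projIcc a b hab ζ).2).eq]
  · intro ζ x
    have h := inner_act_nonneg (hb _ (projIcc a b hab ζ).2).1 x
    rw [act_sub, act_smul, act_one, inner_sub_right, real_inner_smul_right,
      real_inner_self_eq_norm_sq] at h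
    exact sub_nonneg.1 h
  · intro x y
    change ⟪act 𝕂 _ x, y⟫_ℝ = ⟪x, act 𝕂 _ y⟫_ℝ
    rw [act_inner, hQ.P₁_symm.eq]
  · intro x y
    change ⟪act 𝕂 _ x, y⟫_ℝ = ⟪x, act 𝕂 _ y⟫_ℝ
    rw [act_inner, Matrix.transpose_nonsing_inv, hQ.P₁_symm.eq]
  · intro x
    change act 𝕂 _ (act 𝕂 _ x) = x
    rw [← act_mul, Matrix.nonsing_inv_mul _ hdet, act_one]
  · intro x
    change act 𝕂 _ (act 𝕂 _ x) = x
    rw [← act_mul, Matrix.mul_nonsing_inv _ hdet, act_one]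
  · intro x
    change ⟪act 𝕂 _ x, x⟫_ℝ = 0
    have h : ⟪act 𝕂 Q.P₀ x, x⟫_ℝ = -⟪act 𝕂 Q.P₀ x, x⟫_ℝ := by
      conv_lhs => rw [act_inner, hQ.P₀_skew, act_neg, inner_neg_right, real_inner_comm]
    linarith
  · intro ζ x
    have h1 := inner_act_nonneg (hγH _ (projIcc a b hab ζ).2).1 x
    have h2 := inner_act_nonneg (hγH _ (projIcc a b hab ζ).2).2 x
    rw [act_sub, act_smul, inner_sub_right, real_inner_smul_right] at h1
    rw [act_add, act_smul, inner_add_right, real_inner_smul_right] at h2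
    simp only [System.Hext, actL_apply]
    rw [abs_le]
    constructor <;> linarith
  · intro x y h
    exact hQ.dissipative ((Q.boundaryMap_eq_zero_iff x y).1 h)

end Extension

/-! ### Classical solutions as continuous fields -/

section Regularity

variable {𝕂 : Type*} [RCLike 𝕂] {n : ℕ} {a b : ℝ}

theorem L2.exists_integral_norm_le (𝕂 : Type*) [RCLike 𝕂] (n : ℕ) (a b : ℝ) :
    ∃ C, 0 ≤ C ∧ ∀ f : L2 𝕂 n a b, ∫ s in Icc a b, ‖f s‖ ≤ C * ‖f‖ := by
  refine ⟨((volume.restrict (Icc a b)) univ ^ (1 / (1 : ENNReal).toReal -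
    1 / (2 : ENNReal).toReal)).toReal, ENNReal.toReal_nonneg, fun f => ?_⟩
  have hf := Lp.aestronglyMeasurable f
  rw [integral_norm_eq_lintegral_enorm hf, ← eLpNorm_one_eq_lintegral_enorm, mul_comm, Lp.norm_def,
    ← ENNReal.toReal_mul]
  refine ENNReal.toReal_mono (ENNReal.mul_ne_top (Lp.eLpNorm_ne_top f) ?_)
    (eLpNorm_le_eLpNorm_mul_rpow_measure_univ (by norm_num) hf)
  exact ENNReal.rpow_ne_top_of_nonneg (by norm_num) (measure_ne_top _ _)

theorem L2.norm_integral_le (f : L2 𝕂 n a b) {s t : ℝ} (hs : s ∈ Icc a b) (ht : t ∈ Icc a b) :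
    ‖∫ r in s..t, f r‖ ≤ ∫ r in Icc a b, ‖f r‖ := by
  refine intervalIntegral.norm_integral_le_integral_norm_uIoc.trans ?_
  refine setIntegral_mono_set (L2.integrable f).norm (Eventually.of_forall fun _ => norm_nonneg _)
    (LE.le.eventuallyLE ?_)
  exact uIoc_subset_uIcc.trans (uIcc_subset_Icc hs ht)

/-- Integration over `[a,ζ]` as a continuous linear map on `L²`. -/
noncomputable def L2.primitive (𝕂 : Type*) [RCLike 𝕂] (n : ℕ) {a b ζ : ℝ} (hζ : ζ ∈ Icc a b) :
    L2 𝕂 n a b →L[ℝ] Vec 𝕂 n :=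
  LinearMap.mkContinuousOfExistsBound
    { toFun := fun f => ∫ s in a..ζ, f s
      map_add' := fun f g => by
        rw [integral_congr_of_ae hζ (Lp.coeFn_add f g)]
        exact intervalIntegral.integral_add (f.intervalIntegrable hζ) (g.intervalIntegrable hζ)
      map_smul' := fun c f => by
        rw [integral_congr_of_ae hζ (Lp.coeFn_smul c f)]
        exact intervalIntegral.integral_smul c _ }
    (by
      obtain ⟨C, -, hC⟩ := L2.exists_integral_norm_le 𝕂 n a b
      exact ⟨C, fun f => (f.norm_integral_le (left_mem_Icc.2 (hζ.1.trans hζ.2)) hζ).trans (hC f)⟩)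

theorem L2.primitive_apply {ζ : ℝ} (hζ : ζ ∈ Icc a b) (f : L2 𝕂 n a b) :
    L2.primitive 𝕂 n hζ f = ∫ s in a..ζ, f s := rfl

theorem HasH1Deriv.sub {u u' : ℝ → Vec 𝕂 n} {v v' : L2 𝕂 n a b} (h : HasH1Deriv u v)
    (h' : HasH1Deriv u' v') : HasH1Deriv (fun ζ => u ζ - u' ζ) (v - v') := by
  intro ζ hζ
  rw [integral_congr_of_ae hζ (Lp.coeFn_sub v v')]
  simp only [Pi.sub_apply]
  rw [intervalIntegral.integral_sub (v.intervalIntegrable hζ) (v'.intervalIntegrable hζ),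
    h ζ hζ, h' ζ hζ]
  abel

/-- `u` is the continuous representative of `H x`, `v` is its derivative, and
`y = P₁ v + P₀ u`. -/
structure System.IsRep (Q : System n) (x y : L2 𝕂 n a b) (u : ℝ → Vec 𝕂 n) (v : L2 𝕂 n a b) :
    Prop where
  eq_H : ∀ᵐ ζ ∂(volume.restrict (Icc a b)), u ζ = act 𝕂 (Q.H ζ) (x ζ)
  h1 : HasH1Deriv u v
  eq_P : ∀ᵐ ζ ∂(volume.restrict (Icc a b)), y ζ = act 𝕂 Q.P₁ (v ζ) + act 𝕂 Q.P₀ (u ζ)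

theorem System.IsRep.sub {Q : System n} {x y x' y' : L2 𝕂 n a b} {u u' : ℝ → Vec 𝕂 n}
    {v v' : L2 𝕂 n a b} (h : Q.IsRep x y u v) (h' : Q.IsRep x' y' u' v') :
    Q.IsRep (x - x') (y - y') (fun ζ => u ζ - u' ζ) (v - v') := by
  refine ⟨?_, h.h1.sub h'.h1, ?_⟩
  · filter_upwards [h.eq_H, h'.eq_H, Lp.coeFn_sub x x'] with ζ e1 e2 e3
    rw [e3, Pi.sub_apply, map_sub, e1, e2]
  · filter_upwards [h.eq_P, h'.eq_P, Lp.coeFn_sub y y', Lp.coeFn_sub v v'] with ζ e1 e2 e3 e4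
    rw [e3, e4, Pi.sub_apply, Pi.sub_apply, map_sub, map_sub, e1, e2]
    abel

/-- The supremum of `H x` is controlled by the graph norm of `x`. -/
theorem System.Admissible.exists_sup_bound {Q : System n} (hQ : Q.Admissible a b) (hab : a < b) :
    ∃ C, ∀ (x y : L2 𝕂 n a b) (u : ℝ → Vec 𝕂 n) (v : L2 𝕂 n a b), Q.IsRep x y u v →
      ∀ ζ ∈ Icc a b, ‖u ζ‖ ≤ C * (‖x‖ + ‖y‖) := by
  obtain ⟨C₀, hC₀, hint⟩ := L2.exists_integral_norm_le 𝕂 n a b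
  have hcont : Continuous fun ζ => actL 𝕂 (Q.H (projIcc a b hab.le ζ)) := continuous_actL
    fun i j => continuous_comp_projIcc hab.le (hQ.H_contDiff i j).continuousOn
  obtain ⟨K, hK⟩ := (isCompact_Icc (a := a) (b := b)).exists_bound_of_continuousOn
    hcont.continuousOn
  have hK0 : 0 ≤ K := (norm_nonneg _).trans (hK a (left_mem_Icc.2 hab.le))
  set r := ‖actL 𝕂 Q.P₁⁻¹‖
  set p := ‖actL 𝕂 Q.P₀‖
  have hr0 : 0 ≤ r := norm_nonneg _
  have hp0 : 0 ≤ p := norm_nonneg _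
  have hba : 0 < b - a := sub_pos.2 hab
  have hdet := (Matrix.isUnit_iff_isUnit_det _).1 hQ.P₁_invertible
  refine ⟨(b - a)⁻¹ * (K * C₀) + r * C₀ + r * p * K * C₀, fun x y u v h ζ hζ => ?_⟩
  have hu : ∀ᵐ s ∂(volume.restrict (Icc a b)), ‖u s‖ ≤ K * ‖x s‖ := by
    filter_upwards [h.eq_H, ae_restrict_mem measurableSet_Icc] with s e hs
    rw [e, ← actL_apply]
    have := hK s hs
    rw [coe_projIcc_of_mem hab.le hs] at this
    exact (ContinuousLinearMap.le_opNorm _ _).trans (by gcongr)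
  have hv : ∀ᵐ s ∂(volume.restrict (Icc a b)), ‖v s‖ ≤ r * ‖y s‖ + r * p * K * ‖x s‖ := by
    filter_upwards [h.eq_P, hu] with s e hus
    have hvs : v s = actL 𝕂 Q.P₁⁻¹ (y s - actL 𝕂 Q.P₀ (u s)) := by
      rw [actL_apply, actL_apply, e, add_sub_cancel_right, ← act_mul,
        Matrix.nonsing_inv_mul _ hdet, act_one]
    rw [hvs]
    calc _ ≤ r * ‖y s - actL 𝕂 Q.P₀ (u s)‖ := ContinuousLinearMap.le_opNorm _ _
      _ ≤ r * (‖y s‖ + p * (K * ‖x s‖)) := by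
          gcongr
          refine (norm_sub_le _ _).trans ?_
          gcongr
          exact ContinuousLinearMap.le_opNorm_of_le _ hus
      _ = _ := by ring
  have hui : IntegrableOn u (Icc a b) := h.h1.continuousOn.integrableOn_Icc
  have hx := (L2.integrable x).norm
  have hy := (L2.integrable y).norm
  have hu' : ∫ s in Icc a b, ‖u s‖ ≤ K * (C₀ * ‖x‖) := by
    refine (integral_mono_ae hui.norm (hx.const_mul K) hu).trans ?_
    rw [integral_const_mul]
    exact mul_le_mul_of_nonneg_left (hint x) hK0
  have hv' : ∫ s in Icc a b, ‖v s‖ ≤ r * (C₀ * ‖y‖) + r * p * K * (C₀ * ‖x‖) := by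
    refine (integral_mono_ae (L2.integrable v).norm
      ((hy.const_mul r).add (hx.const_mul (r * p * K))) hv).trans ?_
    have hadd : ∫ s in Icc a b, ((fun s => r * ‖y s‖) + fun s => r * p * K * ‖x s‖) s =
        r * (∫ s in Icc a b, ‖y s‖) + r * p * K * ∫ s in Icc a b, ‖x s‖ := by
      rw [← integral_const_mul, ← integral_const_mul]
      exact integral_add (hy.const_mul r) (hx.const_mul (r * p * K))
    refine hadd.trans_le ?_
    have := hint x
    have := hint y
    gcongr
  -- compare with the value at an arbitrary point and average over that point
  have hpt : ∀ s ∈ Icc a b, ‖u ζ‖ ≤ ‖u s‖ + ∫ s in Icc a b, ‖v s‖ := by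
    intro s hs
    have e : u ζ = u s + ∫ z in s..ζ, v z := by
      rw [h.h1 ζ hζ, h.h1 s hs, add_assoc, intervalIntegral.integral_add_adjacent_intervals
        (v.intervalIntegrable hs) ((v.intervalIntegrable hs).symm.trans (v.intervalIntegrable hζ))]
    rw [e]
    exact (norm_add_le _ _).trans (by gcongr; exact v.norm_integral_le hs hζ)
  have hav : (b - a) * ‖u ζ‖ ≤ (∫ s in Icc a b, ‖u s‖) + (b - a) * ∫ s in Icc a b, ‖v s‖ := by
    have hvol : (volume.restrict (Icc a b)).real univ = b - a := by
      rw [measureReal_restrict_apply_univ, Real.volume_real_Icc_of_le hab.le]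
    have := setIntegral_mono_on (μ := volume) (f := fun _ => ‖u ζ‖)
      (g := fun s => ‖u s‖ + ∫ s in Icc a b, ‖v s‖) (by simp) (hui.norm.add (by simp))
      measurableSet_Icc hpt
    rw [integral_add hui.norm (by simp), integral_const, integral_const, hvol, smul_eq_mul,
      smul_eq_mul] at this
    exact this
  have hle : ‖u ζ‖ ≤ (b - a)⁻¹ * (K * (C₀ * ‖x‖)) +
      (r * (C₀ * ‖y‖) + r * p * K * (C₀ * ‖x‖)) := by
    rw [← mul_le_mul_iff_right₀ hba, mul_add, mul_inv_cancel_left₀ hba.ne']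
    exact hav.trans (by gcongr)
  refine hle.trans ?_
  have h1 : 0 ≤ (b - a)⁻¹ * (K * C₀) * ‖y‖ := by positivity
  have h2 : 0 ≤ r * C₀ * ‖x‖ := by positivity
  have h3 : 0 ≤ r * p * K * C₀ * ‖y‖ := by positivity
  linarith

/-- A curve that is continuous in the graph norm has a jointly continuous representative. -/
theorem System.Admissible.continuous_rep {Q : System n} (hQ : Q.Admissible a b) (hab : a < b)
    {x y v : ℝ → L2 𝕂 n a b} {u : ℝ → ℝ → Vec 𝕂 n} (hx : Continuous x) (hy : Continuous y)
    (h : ∀ t, Q.IsRep (x t) (y t) (u t) (v t)) :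
    Continuous fun z : ℝ × ℝ => u z.1 (projIcc a b hab.le z.2) := by
  obtain ⟨C, hC⟩ := hQ.exists_sup_bound (𝕂 := 𝕂) hab
  rw [continuous_iff_continuousAt]
  rintro ⟨t₀, ζ₀⟩
  have hspace : Continuous fun z : ℝ × ℝ => u t₀ (projIcc a b hab.le z.2) :=
    (continuous_comp_projIcc hab.le (h t₀).h1.continuousOn).comp continuous_snd
  have htime : Continuous fun z : ℝ × ℝ => C * (‖x z.1 - x t₀‖ + ‖y z.1 - y t₀‖) := by
    fun_prop
  have hsum := (htime.tendsto (t₀, ζ₀)).add (tendsto_iff_norm_sub_tendsto_zero.1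
    (hspace.tendsto (t₀, ζ₀)))
  simp only [sub_self, norm_zero, add_zero, mul_zero] at hsum
  refine tendsto_iff_norm_sub_tendsto_zero.2 (squeeze_zero (fun _ => norm_nonneg _) ?_ hsum)
  rintro ⟨t, ζ⟩
  refine (norm_sub_le_norm_sub_add_norm_sub _ (u t₀ (projIcc a b hab.le ζ)) _).trans ?_
  gcongr
  exact hC _ _ _ _ ((h t).sub (h t₀)) _ (projIcc a b hab.le ζ).2

/-- A classical solution has a jointly continuous representative, which solves the equation
integrated in time and space. -/
theorem IsClassicalSolution.exists_mildField {Q : System n} (hQ : Q.Admissible a b) (hab : a < b)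
    {x : ℝ → L2 𝕂 n a b} (hx : IsClassicalSolution (Q.op 𝕂 a b) x) :
    ∃ w, IsMildField a b (Q.Hext 𝕂 hab.le) (actL 𝕂 Q.P₁) (actL 𝕂 Q.P₀) (Q.boundaryMap 𝕂) w ∧
      ∀ t, 0 ≤ t → x t =ᵐ[volume.restrict (Icc a b)] w t := by
  have hmem : ∀ t : ℝ, max t 0 ∈ Ici (0 : ℝ) := fun t => le_max_right t 0
  have hmax : Continuous fun t : ℝ => max t 0 := by fun_prop
  -- the solution is extended to negative times by its initial value
  have hxc : Continuous fun t => x (max t 0) := hx.contDiffOn.continuousOn.comp_continuous hmax hmem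
  have hyc : Continuous fun t => derivWithin x (Ici 0) (max t 0) :=
    (hx.contDiffOn.continuousOn_derivWithin (uniqueDiffOn_Ici 0) le_rfl).comp_continuous hmax hmem
  have hgraph : ∀ t, Q.GraphRel (x (max t 0)) (derivWithin x (Ici 0) (max t 0)) := by
    intro t
    rw [← Q.mem_op_graph_iff hab, (hx.hasDeriv _ (hmem t)).derivWithin
      (uniqueDiffOn_Ici 0 _ (hmem t))]
    exact LinearPMap.mem_graph _ ⟨x (max t 0), hx.mem_domain _ (hmem t)⟩
  choose u v huH hH1 hbc hyP using hgraph
  have hrep : ∀ t, Q.IsRep (x (max t 0)) (derivWithin x (Ici 0) (max t 0)) (u t) (v t) :=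
    fun t => ⟨huH t, hH1 t, hyP t⟩
  have huc := hQ.continuous_rep hab hxc hyc hrep
  set w : ℝ → ℝ → Vec 𝕂 n := fun t ζ =>
    actL 𝕂 (Q.H (projIcc a b hab.le ζ))⁻¹ (u t (projIcc a b hab.le ζ)) with hw
  have hinv : Continuous fun ζ => actL 𝕂 (Q.H (projIcc a b hab.le ζ))⁻¹ := continuous_actL
    fun i j => (continuous_comp_projIcc hab.le hQ.continuousOn_H_inv).matrix_elem i j
  have hwc : Continuous (uncurry w) := (hinv.comp continuous_snd).clm_apply huc
  have hHw : ∀ t, ∀ ζ ∈ Icc a b, Q.Hext 𝕂 hab.le ζ (w t ζ) = u t ζ := by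
    intro t ζ hζ
    simp only [hw, System.Hext, coe_projIcc_of_mem hab.le hζ, actL_apply]
    rw [← act_mul, Matrix.mul_nonsing_inv _ (hQ.isUnit_det_H hζ), act_one]
  have hxw : ∀ t, x (max t 0) =ᵐ[volume.restrict (Icc a b)] w t := by
    intro t
    filter_upwards [huH t, ae_restrict_mem measurableSet_Icc] with ζ e hζ
    simp only [hw, coe_projIcc_of_mem hab.le hζ, actL_apply]
    rw [e, ← act_mul, Matrix.nonsing_inv_mul _ (hQ.isUnit_det_H hζ), act_one]
  refine ⟨w, ⟨hwc, ?_, ?_⟩, fun t ht => by simpa [max_eq_left ht] using hxw t⟩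
  · intro t₁ t₂ ht₁ ht ζ hζ
    have haI : a ∈ Icc a b := left_mem_Icc.2 hab.le
    have hfun : ∀ t, L2.primitive 𝕂 n hζ (x (max t 0)) = ∫ s in a..ζ, w t s := fun t =>
      integral_congr_of_ae hζ (hxw t)
    have hfun' : ∀ t, L2.primitive 𝕂 n hζ (derivWithin x (Ici 0) (max t 0)) =
        actL 𝕂 Q.P₁ (Q.Hext 𝕂 hab.le ζ (w t ζ) - Q.Hext 𝕂 hab.le a (w t a)) +
          actL 𝕂 Q.P₀ (∫ s in a..ζ, Q.Hext 𝕂 hab.le s (w t s)) := by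
      intro t
      have hui : IntervalIntegrable (u t) volume a ζ := by
        refine ContinuousOn.intervalIntegrable ((hH1 t).continuousOn.mono ?_)
        exact uIcc_subset_Icc haI hζ
      have hI : ∫ s in a..ζ, Q.Hext 𝕂 hab.le s (w t s) = ∫ s in a..ζ, u t s := by
        refine intervalIntegral.integral_congr fun s hs => ?_
        exact hHw t s (uIcc_subset_Icc haI hζ hs)
      rw [L2.primitive_apply, integral_congr_of_ae hζ (hyP t), hHw t ζ hζ, hHw t a haI, hI,
        (hH1 t) ζ hζ, add_sub_cancel_left,
        ← ContinuousLinearMap.intervalIntegral_comp_comm _ ((v t).intervalIntegrable hζ),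
        ← ContinuousLinearMap.intervalIntegral_comp_comm _ hui]
      refine intervalIntegral.integral_add ?_ ?_
      · exact ⟨(actL 𝕂 Q.P₁).integrable_comp ((v t).intervalIntegrable hζ).1,
          (actL 𝕂 Q.P₁).integrable_comp ((v t).intervalIntegrable hζ).2⟩
      · exact ⟨(actL 𝕂 Q.P₀).integrable_comp hui.1, (actL 𝕂 Q.P₀).integrable_comp hui.2⟩
    have hwi : ∀ t, IntervalIntegrable (w t) volume a ζ := fun t =>
      (hwc.comp (Continuous.prodMk_right t)).intervalIntegrable _ _
    rw [intervalIntegral.integral_sub (hwi t₂) (hwi t₁), ← hfun, ← hfun]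
    simp only [← hfun']
    symm
    refine intervalIntegral.integral_eq_sub_of_hasDerivAt_of_le
      (f := fun t => L2.primitive 𝕂 n hζ (x (max t 0))) ht
      ((L2.primitive 𝕂 n hζ).continuous.comp hxc).continuousOn ?_
      (((L2.primitive 𝕂 n hζ).continuous.comp hyc).intervalIntegrable _ _)
    intro t htI
    have htpos : 0 < t := ht₁.trans_lt htI.1
    have hd : HasDerivAt x (derivWithin x (Ici 0) t) t :=
      ((hx.contDiffOn.differentiableOn one_ne_zero) t htpos.le).hasDerivWithinAt.hasDerivAt
        (Ici_mem_nhds htpos)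
    rw [max_eq_left htpos.le]
    refine ((L2.primitive 𝕂 n hζ).hasFDerivAt.comp_hasDerivAt t hd).congr_of_eventuallyEq ?_
    filter_upwards [Ioi_mem_nhds htpos] with s hs
    simp [max_eq_left (le_of_lt (mem_Ioi.1 hs))]
  · intro t _
    rw [hHw t b (right_mem_Icc.2 hab.le), hHw t a (left_mem_Icc.2 hab.le)]
    exact (Q.boundaryMap_eq_zero_iff _ _).2 (hbc t)

end Regularity

/-! ### Observability and admissibility -/

section Densities

variable {𝕂 : Type*} [RCLike 𝕂] {n : ℕ} {a b : ℝ}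

theorem System.density_eq (Q : System n) (hab : a < b) {x : ℝ → L2 𝕂 n a b}
    {w : ℝ → ℝ → Vec 𝕂 n} {t δ : ℝ} (hw : Continuous (w t))
    (hx : x t =ᵐ[volume.restrict (Icc a b)] w t) (hδ : δ ∈ Icc a b) :
    Q.density x t δ = ⟪w t δ, Q.Hext 𝕂 hab.le δ (w t δ)⟫_ℝ := by
  rw [System.density, pointValue_eq hab hw.continuousOn hx hδ, quadForm_eq, Q.Hext_apply _ hδ]

theorem System.energy_eq (Q : System n) (hab : a < b) {f : L2 𝕂 n a b} {w : ℝ → Vec 𝕂 n}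
    (hf : f =ᵐ[volume.restrict (Icc a b)] w) :
    Q.energy f = 1 / 2 * ∫ ζ in a..b, ⟪w ζ, Q.Hext 𝕂 hab.le ζ (w ζ)⟫_ℝ := by
  rw [System.energy, intervalIntegral.integral_of_le hab.le, ← integral_Icc_eq_integral_Ioc]
  congr 1
  refine integral_congr_ae ?_
  filter_upwards [hf, ae_restrict_mem measurableSet_Icc] with ζ e hζ
  rw [e, quadForm_eq, Q.Hext_apply _ hζ]

end Densities

end PortHam

theorem mainTheorem2 {𝕂 : Type*} [RCLike 𝕂] {n : ℕ} {a b : ℝ} (hab : a < b)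
    (Q : PortHam.System n) (hQ : Q.Admissible a b)
    (σ τ γ : ℝ) (hγ : 0 < γ) (hσ : γ * (b - a) ≤ σ) (hστ : σ < τ)
    (hγH : ∀ ζ ∈ Set.Icc a b,
      (γ • Q.H ζ - Q.P₁⁻¹).PosSemidef ∧ (γ • Q.H ζ + Q.P₁⁻¹).PosSemidef)
    (S T : ℝ) (hS : S = σ - γ * (b - a)) (hT : T = τ + γ * (b - a)) :
    ∃ c d : ℝ, 0 < c ∧ 0 < d ∧
      ∀ x : ℝ → PortHam.L2 𝕂 n a b, PortHam.IsClassicalSolution (Q.op 𝕂 a b) x →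
        ∀ δ ∈ ({a, b} : Set ℝ),
          IntervalIntegrable (fun t => Q.density x t δ) MeasureTheory.volume S T ∧
          Q.energy (x T) ≤ c * (∫ t in S..T, Q.density x t δ) ∧
          (∫ t in σ..τ, Q.density x t δ) ≤ d * Q.energy (x S) := by
  obtain ⟨m, hK⟩ := hQ.coefficients (𝕂 := 𝕂) hab.le hγ hγH
  obtain ⟨C, hC0, hC⟩ := hK.exists_source_bound
  have hba : 0 < b - a := sub_pos.2 hab
  have hγba : 0 < γ * (b - a) := mul_pos hγ hba
  have hτσ : 0 < τ - σ := sub_pos.2 hστ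
  have hTS : 0 < T - S := by rw [hS, hT]; linarith
  have hS0 : 0 ≤ S := by rw [hS]; linarith
  have hc : 0 < (b - a) * Real.exp (C * (b - a)) / (2 * (τ - σ)) := by positivity
  have hd : 0 < 2 * Real.exp (C * (b - a)) * (T - S) / (b - a) := by positivity
  refine ⟨_, _, hc, hd, ?_⟩
  intro x hx δ hδ
  have hδI : δ ∈ Set.Icc a b := by
    rcases hδ with rfl | rfl
    · exact Set.left_mem_Icc.2 hab.le
    · exact Set.right_mem_Icc.2 hab.le
  obtain ⟨w, hw, hxw⟩ := hx.exists_mildField hQ hab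
  have hden : ∀ t, 0 ≤ t →
      Q.density x t δ = inner ℝ (w t δ) (Q.Hext 𝕂 hab.le δ (w t δ)) := fun t ht =>
    Q.density_eq hab (hw.cont.comp (Continuous.prodMk_right t)) (hxw t ht) hδI
  have hcont := PortHam.continuous_density_time hK.H_cont hw.cont δ
  have hint : ∀ s t, 0 ≤ s → s ≤ t → ∫ r in s..t, Q.density x r δ =
      ∫ r in s..t, inner ℝ (w r δ) (Q.Hext 𝕂 hab.le δ (w r δ)) := by
    intro s t hs hst
    refine intervalIntegral.integral_congr fun r hr => hden r ?_
    rw [Set.uIcc_of_le hst] at hr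
    exact hs.trans hr.1
  refine ⟨?_, ?_, ?_⟩
  · refine (hcont.intervalIntegrable S T).congr fun t ht => ?_
    rw [Set.uIoc_of_le (by linarith)] at ht
    exact (hden t (hS0.trans ht.1.le)).symm
  · have h := hw.energy_le_observation hK hab.le hC0 hC hδI hστ.le hσ
    rw [← hS, ← hT] at h
    rw [hint S T hS0 (by linarith), div_mul_eq_mul_div, le_div_iff₀ (by linarith),
      Q.energy_eq hab (hxw T (by linarith))]
    linarith
  · have h := hw.observation_le_energy hK hab.le hC0 hC hδI hστ.le hσ
    rw [← hS, ← hT] at h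
    rw [hint σ τ (by linarith) hστ.le, div_mul_eq_mul_div, le_div_iff₀ hba,
      Q.energy_eq hab (hxw S hS0)]
    linarith
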